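/- Let $0<T<\infty$, $0<A<\infty$ and let $p\ge 1$ be real. Let $X=\{X(t),\ t\in[0,T+A]\}$ be a real-valued, jointly measurable, centered, stationary Gaussian process on a probability space $(\Omega,\mathcal F,P)$, with covariance function $\rho(\tau)=\mathbf E\,X(t+\tau)X(t)$ (defined for $|\tau|\le T+A$, and then even), and assume that $\rho$ is continuous on $[0,T+A]$. For $0\le\tau\le A$ let $$\hat\rho(\tau)=\frac1T\int_0^T X(t+\tau)X(t)\,dt$$ be the correlogram, and put $$C_p=\int_0^A\Bigl(\frac{2}{T^2}\int_0^T (T-u)\bigl(\rho^2(u)+\rho(u+\tau)\rho(u-\tau)\bigr)\,du\Bigr)^{p/2}d\tau .$$ Then, with probability one, the integral defining $\hat\rho(\tau)$ converges for all $\tau\in[0,A]$ and the integral $\int_0^A|\hat\rho(\tau)-\rho(\tau)|^p\,d\tau$ exists and is finite; and for every $$\varepsilon\ \ge\ \Bigl(\frac{p}{\sqrt2}+\sqrt{\bigl(\tfrac p2+1\bigr)p}\Bigr)^{p}\,C_p$$ one has $$P\Bigl\{\int_0^A|\hat\rho(\tau)-\rho(\tau)|^p\,d\tau>\varepsilon\Bigr\}\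 \le\ 2\sqrt{1+\frac{\varepsilon^{1/p}\sqrt2}{C_p^{1/p}}}\ \exp\Bigl\{-\frac{\varepsilon^{1/p}}{\sqrt2\,C_p^{1/p}}\Bigr\}.$$ (In the degenerate case $C_p=0$, that is $\rho(0)=0$, the quotients by $C_p^{1/p}$ are read as $0$.) -/

import Mathlib

open MeasureTheory ProbabilityTheory

noncomputable section

/-- The correlogram `ρ̂(τ) = (1/T) ∫₀ᵀ X(t+τ) X(t) dt`, path by path (`T` is the length of the
averaging window and `ω` the sample point). -/
def correlogram {Ω : Type*} (X : ℝ → Ω → ℝ) (T τ : ℝ) (ω : Ω) : ℝ :=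
  (1 / T) * ∫ t in (0 : ℝ)..T, X (t + τ) ω * X t ω

/-- The constant
`C_p = ∫₀ᴬ ( (2/T²) ∫₀ᵀ (T-u) (ρ(u)² + ρ(u+τ) ρ(u-τ)) du )^{p/2} dτ`. -/
def correlogramConst (ρ : ℝ → ℝ) (T A p : ℝ) : ℝ :=
  ∫ τ in (0 : ℝ)..A,
    ((2 / T ^ 2) * ∫ u in (0 : ℝ)..T,
      (T - u) * (ρ u ^ 2 + ρ (u + τ) * ρ (u - τ))) ^ (p / 2)

/-- `X`, observed on the parameter set `I`, is a measurable (jointly in time and sample point),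
centered, stationary Gaussian process with covariance function `ρ`. Stationarity is asked for in
the form that the mean and the covariance `E X(t+τ) X(t) = ρ(τ)` do not depend on `t`, which for a
Gaussian process is the same as shift invariance of its finite-dimensional laws. -/
structure IsMeasurableStationaryGaussian {Ω : Type*} [MeasurableSpace Ω]
    (X : ℝ → Ω → ℝ) (ρ : ℝ → ℝ) (I : Set ℝ) (P : Measure Ω) : Prop where
  measurable : Measurable (fun q : I × Ω => X q.1 q.2)
  gaussian : IsGaussianProcess (fun t : I => X t) P
  centered : ∀ t ∈ I, ∫ ω, X t ω ∂P = 0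
  covariance : ∀ t τ : ℝ, t ∈ I → t + τ ∈ I → ∫ ω, X (t + τ) ω * X t ω ∂P = ρ τ

end

/-!
The deviation `ξ(τ) = ρ̂(τ) - ρ(τ)` of the correlogram is a limit of centered quadratic forms in
Gaussian variables, and such variables have exponential moments controlled by their variance alone.

*Laplace transform.* After diagonalization, a centered Gaussian quadratic form reads
`∑ lᵢ (gᵢ² - 1)` with independent standard `gᵢ` and has variance `D = 2 ∑ lᵢ²`. Its Laplace
transform at `c` is `exp (½ ∑ (-log (1 - 2clᵢ) - 2clᵢ))`. As `x ↦ (-log (1 - x) - x) / x²` has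
nonnegative Taylor coefficients, this is at most `(1 - s)^{-1/2} e^{-s/2}` when `2c²D ≤ s² < 1`
(`lintegral_exp_quadraticForm_stdGaussian_le`). For `∑ Uₖ Vₖ` with jointly Gaussian `Uₖ, Vₖ` the
number `2 ∑ lᵢ²` is a trace, which expands to the Isserlis expression in the covariances
(`lintegral_exp_sum_mul_le`); no fourth moment has to be computed. Riemann sums of the correlogram
converge in `L¹`, and their variances converge to `D(τ) = Var ρ̂(τ)` because the covariance is
continuous, so Fatou's lemma carries the bound over to `ξ(τ)`
(`IsContinuousCovGaussian.lintegral_exp_correlogram_sub_le`).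

*Moments.* From `x^q ≤ (q/c)^q e^{-q} e^{cx}` with `c = s / √(2 D(τ))` one gets
`E |ξ(τ)|^q ≤ (2 D(τ))^{q/2} K` with `K = 2 (q/s)^q e^{-q} (1 - s)^{-1/2} e^{-s/2}`. Minkowski's
integral inequality (`lintegral_rpow_lintegral_rpow_le`) turns this, for `q ≥ p`, into
`E (∫ |ξ|^p)^{q/p} ≤ 2^{q/2} C_p^{q/p} K`.

*Tail.* Markov's inequality is optimized over `q` and `s` (`exists_optimal_parameters`). With
`x = (ε / C_p)^{1/p}` the best choice is `q = s x / √2` and `s = √2 x / (1 + √2 x)`; it is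
admissible, that is `q ≥ p`, exactly under the assumed lower bound for `ε`.

The process is observed on `[0, T + A]` only. Composing it with the projection of the line onto
that interval gives a process on the whole line with continuous covariance kernel, to which the
general results apply; evenness of `ρ` reduces `D(τ)` to the single integral in `C_p`.
-/

open Filter Topology
open scoped ENNReal

/-! ### Laplace transform of a quadratic form of a standard Gaussian vector -/

/-- The Laplace-transform bound `(1 - s)^{-1/2} e^{-s/2}`: it dominates `E exp (c ξ)` for a centered
quadratic form `ξ` in Gaussian variables, where `s² = 2 c² Var ξ`. -/
noncomputable def sqGaussianBound (s : ℝ) : ℝ := (√(1 - s))⁻¹ * Real.exp (-s / 2)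

lemma sqGaussianBound_eq_exp {s : ℝ} (hs : s < 1) :
    sqGaussianBound s = Real.exp ((-Real.log (1 - s) - s) / 2) := by
  have h : (0 : ℝ) < 1 - s := by linarith
  rw [sqGaussianBound, Real.sqrt_eq_rpow, ← Real.rpow_neg h.le, Real.rpow_def_of_pos h,
    ← Real.exp_add]
  congr 1
  ring

/-- The function `(-log (1 - x) - x) / x²` is largest on `[-s, s]` at `x = s`, because
its power series has nonnegative coefficients. -/
lemma neg_log_one_sub_sub_le {s x : ℝ} (hs : s < 1) (hx : |x| ≤ s) :
    (-Real.log (1 - x) - x) * s ^ 2 ≤ x ^ 2 * (-Real.log (1 - s) - s) := by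
  have hs0 : 0 ≤ s := (abs_nonneg x).trans hx
  have series : ∀ y : ℝ, |y| < 1 →
      HasSum (fun n : ℕ => y ^ (n + 2) / ((n : ℝ) + 2)) (-Real.log (1 - y) - y) := by
    intro y hy
    have h := (hasSum_nat_add_iff' 1).mpr (Real.hasSum_pow_div_log_of_abs_lt_one hy)
    simp only [Finset.range_one, Finset.sum_singleton, Nat.cast_zero, zero_add, pow_one,
      div_one] at h
    convert! h using 2 with n
    push_cast
    ring_nf
  refine hasSum_le (fun n => ?_) ((series x (hx.trans_lt hs)).mul_right (s ^ 2))
    ((series s (by rwa [abs_of_nonneg hs0])).mul_left (x ^ 2))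
  have h1 : x ^ n ≤ s ^ n := by
    calc x ^ n ≤ |x ^ n| := le_abs_self _
      _ = |x| ^ n := abs_pow x n
      _ ≤ s ^ n := pow_le_pow_left₀ (abs_nonneg x) hx n
  have h2 : (0 : ℝ) < (n : ℝ) + 2 := by positivity
  calc x ^ (n + 2) / ((n : ℝ) + 2) * s ^ 2 = x ^ n * (x ^ 2 * s ^ 2 / (n + 2)) := by ring
    _ ≤ s ^ n * (x ^ 2 * s ^ 2 / (n + 2)) := by gcongr
    _ = x ^ 2 * (s ^ (n + 2) / (n + 2)) := by ring

lemma sum_neg_log_one_sub_sub_le {ι : Type*} [Fintype ι] {s : ℝ} (hs0 : 0 < s) (hs : s < 1)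
    (x : ι → ℝ) (hx : ∑ i, x i ^ 2 ≤ s ^ 2) :
    ∑ i, (-Real.log (1 - x i) - x i) ≤ -Real.log (1 - s) - s := by
  have hxi : ∀ i, |x i| ≤ s := fun i => abs_le_of_sq_le_sq
    ((Finset.single_le_sum (fun j _ => sq_nonneg (x j)) (Finset.mem_univ i)).trans hx) hs0.le
  have hL : 0 ≤ -Real.log (1 - s) - s := by
    have := Real.log_le_sub_one_of_pos (show (0 : ℝ) < 1 - s by linarith)
    linarith
  have h := Finset.sum_le_sum fun i (_ : i ∈ Finset.univ) => neg_log_one_sub_sub_le hs (hxi i)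
  rw [← Finset.sum_mul, ← Finset.sum_mul] at h
  have h3 := h.trans (mul_le_mul_of_nonneg_right hx hL)
  rw [mul_comm (s ^ 2)] at h3
  exact le_of_mul_le_mul_right h3 (by positivity)

/-- The exponential of a centered square `l (x² - 1)` under the standard Gaussian. -/
lemma integrable_and_integral_exp_sq_gaussianReal {l : ℝ} (hl : 2 * l < 1) :
    Integrable (fun x => Real.exp (l * x ^ 2 - l)) (gaussianReal 0 1) ∧
      ∫ x, Real.exp (l * x ^ 2 - l) ∂(gaussianReal 0 1)
        = Real.exp ((-Real.log (1 - 2 * l) - 2 * l) / 2) := by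
  have hb : 0 < 1 / 2 - l := by linarith
  have key : ∀ x : ℝ, gaussianPDFReal 0 1 x * Real.exp (l * x ^ 2 - l)
      = ((√(2 * Real.pi))⁻¹ * Real.exp (-l)) * Real.exp (-(1 / 2 - l) * x ^ 2) := by
    intro x
    simp only [gaussianPDFReal, NNReal.coe_one, mul_one, sub_zero]
    rw [mul_assoc, mul_assoc, ← Real.exp_add, ← Real.exp_add]
    ring_nf
  constructor
  · rw [gaussianReal_of_var_ne_zero _ one_ne_zero,
      integrable_withDensity_iff_integrable_smul' (measurable_gaussianPDF 0 1)
        (ae_of_all _ fun x => gaussianPDF_lt_top)]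
    simp only [toReal_gaussianPDF, smul_eq_mul, key]
    exact (integrable_exp_neg_mul_sq hb).const_mul _
  · rw [integral_gaussianReal_eq_integral_smul one_ne_zero]
    simp only [smul_eq_mul, key]
    rw [integral_const_mul, integral_gaussian]
    have h : (0 : ℝ) < 1 - 2 * l := by linarith
    have e := sqGaussianBound_eq_exp hl
    rw [← e, sqGaussianBound]
    have : Real.pi / (1 / 2 - l) = (2 * Real.pi) * (1 - 2 * l)⁻¹ := by
      field_simp
    rw [this, Real.sqrt_mul (x := 2 * Real.pi) (by positivity), Real.sqrt_inv]
    have h2 : √(2 * Real.pi) ≠ 0 := by positivity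
    have h3 : -(2 * l) / 2 = -l := by ring
    rw [h3]
    field_simp

/-- Laplace transform of a centered quadratic form of a standard Gaussian vector, after
diagonalization of its matrix. -/
lemma lintegral_exp_quadraticForm_stdGaussian_le {E : Type*} [NormedAddCommGroup E]
    [InnerProductSpace ℝ E] [FiniteDimensional ℝ E] [MeasurableSpace E] [BorelSpace E]
    (B : E →ₗ[ℝ] E) (hB : B.IsSymmetric) {s : ℝ} (hs0 : 0 < s) (hs : s < 1)
    (htr : 4 * LinearMap.trace ℝ E (B ∘ₗ B) ≤ s ^ 2) :
    ∫⁻ g, ENNReal.ofReal (Real.exp (inner ℝ g (B g) - LinearMap.trace ℝ E B)) ∂(stdGaussian E)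
      ≤ ENNReal.ofReal (sqGaussianBound s) := by
  set b := hB.eigenvectorBasis rfl
  set l := hB.eigenvalues rfl
  have hBb : ∀ i, B (b i) = l i • b i := fun i => hB.apply_eigenvectorBasis rfl i
  have tr1 : LinearMap.trace ℝ E B = ∑ i, l i := by
    rw [LinearMap.trace_eq_sum_inner B b]
    simp [hBb, inner_smul_right]
  have tr2 : LinearMap.trace ℝ E (B ∘ₗ B) = ∑ i, l i ^ 2 := by
    rw [LinearMap.trace_eq_sum_inner _ b]
    simp [hBb, inner_smul_right, sq]
  have hsum : ∑ i, (2 * l i) ^ 2 ≤ s ^ 2 := by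
    simp only [mul_pow, ← Finset.mul_sum]
    rw [← tr2]
    linarith
  have hli : ∀ i, 2 * l i < 1 := fun i => by
    have h1 : (2 * l i) ^ 2 ≤ s ^ 2 :=
      (Finset.single_le_sum (fun j _ => sq_nonneg (2 * l j)) (Finset.mem_univ i)).trans hsum
    exact (le_abs_self _).trans_lt ((abs_le_of_sq_le_sq h1 hs0.le).trans_lt hs)
  have hq : ∀ x : Fin (Module.finrank ℝ E) → ℝ,
      Real.exp (inner ℝ (∑ i, x i • b i) (B (∑ i, x i • b i)) - LinearMap.trace ℝ E B)
        = ∏ i, Real.exp (l i * x i ^ 2 - l i) := by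
    intro x
    rw [← Real.exp_sum, tr1, Finset.sum_sub_distrib]
    congr 2
    simp only [map_sum, map_smul, hBb, smul_smul]
    rw [b.orthonormal.inner_sum]
    exact Finset.sum_congr rfl fun i _ => by simp; ring
  rw [stdGaussian_eq_map_pi_orthonormalBasis b, lintegral_map]
  rotate_left
  · have : Continuous B := B.continuous_of_finiteDimensional
    fun_prop
  · fun_prop
  simp only [hq]
  rw [← ofReal_integral_eq_lintegral_ofReal]
  rotate_left
  · exact Integrable.fintype_prod (f := fun i (y : ℝ) => Real.exp (l i * y ^ 2 - l i))
      fun i => (integrable_and_integral_exp_sq_gaussianReal (hli i)).1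
  · exact ae_of_all _ fun x => Finset.prod_nonneg fun i _ => (Real.exp_pos _).le
  rw [integral_fintype_prod_eq_prod (fun i (y : ℝ) => Real.exp (l i * y ^ 2 - l i))]
  simp only [fun i => (integrable_and_integral_exp_sq_gaussianReal (hli i)).2]
  rw [← Real.exp_sum, sqGaussianBound_eq_exp hs, ← Finset.sum_div]
  gcongr
  exact sum_neg_log_one_sub_sub_le hs0 hs _ hsum

/-! ### Quadratic forms of centered Gaussian vectors -/

/-- The matrix of second moments of a random vector, given by its coordinates. -/
noncomputable def secondMomentMatrix {ι Ω : Type*} [MeasurableSpace Ω] (P : Measure Ω)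
    (Y : ι → Ω → ℝ) : Matrix ι ι ℝ := Matrix.of fun i j => ∫ ω, Y i ω * Y j ω ∂P

section FiniteDimensional

open Matrix
open scoped MatrixOrder

variable {ι Ω : Type*} [Fintype ι] [MeasurableSpace Ω] {P : Measure Ω}

lemma transpose_secondMomentMatrix {ι Ω : Type*} [MeasurableSpace Ω] {P : Measure Ω}
    (Y : ι → Ω → ℝ) : (secondMomentMatrix P Y)ᵀ = secondMomentMatrix P Y := by
  ext i j
  simp [secondMomentMatrix, mul_comm]

lemma posSemidef_secondMomentMatrix {Y : ι → Ω → ℝ} (hY : ∀ i, MemLp (Y i) 2 P) :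
    (secondMomentMatrix P Y).PosSemidef := by
  have hint : ∀ (x : ι → ℝ) i j, Integrable (fun ω => x i * Y i ω * (x j * Y j ω)) P :=
    fun x i j => (((hY i).integrable_mul (hY j)).const_mul (x i * x j)).congr
      (ae_of_all _ fun ω => by simp only [Pi.mul_apply]; ring)
  refine .of_dotProduct_mulVec_nonneg ?_ fun x => ?_
  · rw [IsHermitian, conjTranspose_eq_transpose_of_trivial, transpose_secondMomentMatrix]
  · have : star x ⬝ᵥ secondMomentMatrix P Y *ᵥ x = ∫ ω, (∑ i, x i * Y i ω) ^ 2 ∂P := by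
      simp only [sq, Finset.sum_mul_sum]
      rw [integral_finsetSum _ fun i _ => integrable_finsetSum _ fun j _ => hint x i j]
      simp only [dotProduct, mulVec, Finset.mul_sum, star_trivial]
      refine Finset.sum_congr rfl fun i _ => ?_
      rw [integral_finsetSum _ fun j _ => hint x i j]
      refine Finset.sum_congr rfl fun j _ => ?_
      rw [secondMomentMatrix, of_apply, ← integral_mul_const, ← integral_const_mul]
      exact integral_congr_ae (ae_of_all _ fun ω => by ring)
    rw [this]
    exact integral_nonneg fun ω => sq_nonneg _

variable [DecidableEq ι]

lemma transpose_sqrt_and_sqrt_mul_self {S : Matrix ι ι ℝ} (hS : S.PosSemidef) :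
    (CFC.sqrt S)ᵀ = CFC.sqrt S ∧ CFC.sqrt S * CFC.sqrt S = S := by
  refine ⟨?_, CFC.sqrt_mul_sqrt_self S hS.nonneg⟩
  have h : IsSelfAdjoint (CFC.sqrt S) := (CFC.sqrt_nonneg S).isSelfAdjoint
  rwa [IsSelfAdjoint, star_eq_conjTranspose, conjTranspose_eq_transpose_of_trivial] at h

omit [DecidableEq ι] in
lemma trace_sq_conj (R M : Matrix ι ι ℝ) :
    (R * M * R * (R * M * R)).trace = (M * (R * R) * (M * (R * R))).trace := by
  have h1 : R * M * R * (R * M * R) = R * (M * (R * R) * M * R) := by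
    simp only [Matrix.mul_assoc]
  rw [h1, trace_mul_comm]
  simp only [Matrix.mul_assoc]

lemma trace_sq_mul_nonneg {S M : Matrix ι ι ℝ} (hS : S.PosSemidef) (hM : Mᵀ = M) :
    0 ≤ (M * S * (M * S)).trace := by
  obtain ⟨hRT, hRR⟩ := transpose_sqrt_and_sqrt_mul_self hS
  set R := CFC.sqrt S
  have hB : (R * M * R)ᵀ = R * M * R := by
    rw [transpose_mul, transpose_mul, hRT, hM, Matrix.mul_assoc]
  rw [← hRR, ← trace_sq_conj]
  rw [Matrix.trace]
  refine Finset.sum_nonneg fun i _ => ?_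
  rw [diag_apply, Matrix.mul_apply]
  refine Finset.sum_nonneg fun j _ => ?_
  have hij : (R * M * R) j i = (R * M * R) i j := congrFun (congrFun hB i) j
  rw [hij]
  exact mul_self_nonneg _

lemma map_toLp_eq_multivariateGaussian [IsProbabilityMeasure P] {Y : ι → Ω → ℝ}
    (hY : HasGaussianLaw (fun ω i => Y i ω) P) (hmean : ∀ i, ∫ ω, Y i ω ∂P = 0) :
    P.map (fun ω => WithLp.toLp 2 (fun i => Y i ω))
      = multivariateGaussian 0 (secondMomentMatrix P Y) := by
  have hL2 : ∀ i, MemLp (Y i) 2 P := fun i => (hY.eval i).memLp_two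
  have hS := posSemidef_secondMomentMatrix hL2
  have hZ := hY.toLp_pi 2
  have := hZ.isGaussian_map
  have hm : AEMeasurable (fun ω => WithLp.toLp 2 (fun i => Y i ω)) P := hZ.aemeasurable
  apply IsGaussian.ext
  · rw [integral_id_multivariateGaussian', integral_map hm (by fun_prop)]
    ext i
    have hi := hZ.integrable
    change (∫ ω, (WithLp.toLp 2 fun i => Y i ω : EuclideanSpace ℝ ι) ∂P) i = 0
    rw [← hmean i]
    exact ((EuclideanSpace.proj (𝕜 := ℝ) i).integral_comp_comm hi).symm
  · rw [← ContinuousLinearMap.toBilinForm_inj]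
    refine LinearMap.BilinForm.ext_basis (EuclideanSpace.basisFun ι ℝ).toBasis fun i j ↦ ?_
    rw [ContinuousLinearMap.toBilinForm_apply, ContinuousLinearMap.toBilinForm_apply,
      covarianceBilin_multivariateGaussian hS,
      covarianceBilin_apply_eq_cov IsGaussian.memLp_two_id,
      covariance_map (by fun_prop) (by fun_prop) hm]
    have h (i : ι) : (fun u ↦ inner ℝ ((EuclideanSpace.basisFun ι ℝ).toBasis i) u) ∘
        (fun ω => WithLp.toLp 2 (fun i => Y i ω)) = Y i := by
      ext; simp [PiLp.inner_apply]
    rw [h, h, covariance_eq_sub (hL2 i) (hL2 j), hmean i, hmean j]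
    simp [secondMomentMatrix]

/-- A quadratic form `zᵀ M z` in a centered Gaussian vector with covariance `S` has the law of a
quadratic form in a standard Gaussian vector whose matrix `√S M √S` has the traces of `M S`. -/
lemma lintegral_exp_quadraticForm_le [IsProbabilityMeasure P] {Y : ι → Ω → ℝ}
    (hY : HasGaussianLaw (fun ω i => Y i ω) P) (hmean : ∀ i, ∫ ω, Y i ω ∂P = 0)
    {M : Matrix ι ι ℝ} (hM : Mᵀ = M) {s : ℝ} (hs0 : 0 < s) (hs : s < 1)
    (htr : 4 * (M * secondMomentMatrix P Y * (M * secondMomentMatrix P Y)).trace ≤ s ^ 2) :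
    ∫⁻ ω, ENNReal.ofReal (Real.exp
        ((fun i => Y i ω) ⬝ᵥ M *ᵥ (fun i => Y i ω) - (M * secondMomentMatrix P Y).trace)) ∂P
      ≤ ENNReal.ofReal (sqGaussianBound s) := by
  set S := secondMomentMatrix P Y with hSdef
  have hS : S.PosSemidef := posSemidef_secondMomentMatrix fun i => (hY.eval i).memLp_two
  obtain ⟨hRT, hRR⟩ := transpose_sqrt_and_sqrt_mul_self hS
  set R := CFC.sqrt S
  have hBsymm : (toEuclideanLin (R * M * R)).IsSymmetric := by
    rw [isSymmetric_toEuclideanLin_iff, IsHermitian, conjTranspose_eq_transpose_of_trivial,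
      transpose_mul, transpose_mul, hRT, hM, Matrix.mul_assoc]
  have tr : ∀ N : Matrix ι ι ℝ, LinearMap.trace ℝ _ (toEuclideanLin N) = N.trace := fun N =>
    Matrix.trace_toLin_eq N (PiLp.basisFun 2 ℝ ι)
  have tr1 : (R * M * R).trace = (M * S).trace := by
    rw [Matrix.mul_assoc, trace_mul_comm, Matrix.mul_assoc, hRR]
  have tr2 : (R * M * R * (R * M * R)).trace = (M * S * (M * S)).trace := by
    rw [trace_sq_conj, hRR]
  have hcont : Continuous fun z : EuclideanSpace ℝ ι => z.ofLp ⬝ᵥ M *ᵥ z.ofLp := by fun_prop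
  have hlaw := map_toLp_eq_multivariateGaussian hY hmean
  have hm : AEMeasurable (fun ω => WithLp.toLp 2 (fun i => Y i ω)) P :=
    (hY.toLp_pi 2).aemeasurable
  have e1 : ∫⁻ ω, ENNReal.ofReal (Real.exp
        ((fun i => Y i ω) ⬝ᵥ M *ᵥ (fun i => Y i ω) - (M * S).trace)) ∂P
      = ∫⁻ z : EuclideanSpace ℝ ι, ENNReal.ofReal (Real.exp
        (z.ofLp ⬝ᵥ M *ᵥ z.ofLp - (M * S).trace)) ∂(multivariateGaussian 0 S) := by
    rw [hSdef, ← hlaw, lintegral_map' (by fun_prop) hm]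
  have key := lintegral_exp_quadraticForm_stdGaussian_le _ hBsymm hs0 hs (by
    rw [← toLpLin_mul, tr, tr2]
    exact htr)
  rw [e1, multivariateGaussian, lintegral_map (by fun_prop) (by fun_prop)]
  refine le_trans (le_of_eq ?_) key
  refine lintegral_congr fun g => ?_
  rw [tr, tr1]
  congr 3
  have hin := inner_toEuclideanCLM (R * M * R) g g
  change inner ℝ g (toEuclideanLin (R * M * R) g) = _ at hin
  rw [hin, zero_add, ofLp_toEuclideanCLM]
  conv_lhs => rw [dotProduct_comm, dotProduct_mulVec]
  rw [dotProduct_comm, ← mulVec_transpose, hRT, ← mulVec_mulVec, ← mulVec_mulVec]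

/-- The matrix of the quadratic form `c ∑ₖ uₖ vₖ` in the variables `(u, v)`. -/
noncomputable def pairingMatrix (ι : Type*) [DecidableEq ι] (c : ℝ) :
    Matrix (ι ⊕ ι) (ι ⊕ ι) ℝ :=
  fromBlocks 0 ((c / 2) • (1 : Matrix ι ι ℝ)) ((c / 2) • (1 : Matrix ι ι ℝ)) 0

omit [Fintype ι] in
lemma transpose_pairingMatrix (c : ℝ) : (pairingMatrix ι c)ᵀ = pairingMatrix ι c := by
  simp [pairingMatrix, fromBlocks_transpose]

lemma pairingMatrix_mul (c : ℝ) (S : Matrix (ι ⊕ ι) (ι ⊕ ι) ℝ) :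
    pairingMatrix ι c * S = fromBlocks ((c / 2) • S.toBlocks₂₁) ((c / 2) • S.toBlocks₂₂)
      ((c / 2) • S.toBlocks₁₁) ((c / 2) • S.toBlocks₁₂) := by
  conv_lhs => rw [(fromBlocks_toBlocks S).symm, pairingMatrix, fromBlocks_multiply]
  simp

omit [DecidableEq ι] in
lemma trace_fromBlocks_eq (A B C D : Matrix ι ι ℝ) :
    (fromBlocks A B C D).trace = A.trace + D.trace := by
  simp [Matrix.trace]

lemma trace_pairingMatrix_mul_secondMomentMatrix (c : ℝ) (Y : ι ⊕ ι → Ω → ℝ) :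
    (pairingMatrix ι c * secondMomentMatrix P Y).trace
      = c * ∑ k, ∫ ω, Y (.inl k) ω * Y (.inr k) ω ∂P := by
  rw [pairingMatrix_mul, trace_fromBlocks_eq, Finset.mul_sum, Matrix.trace, Matrix.trace,
    ← Finset.sum_add_distrib]
  refine Finset.sum_congr rfl fun k _ => ?_
  simp only [toBlocks₂₁, toBlocks₁₂, secondMomentMatrix, diag_apply, Matrix.smul_apply,
    of_apply, smul_eq_mul, mul_comm (Y (.inr k) _)]
  ring

lemma trace_sq_pairingMatrix_mul_secondMomentMatrix (c : ℝ) (Y : ι ⊕ ι → Ω → ℝ) :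
    (pairingMatrix ι c * secondMomentMatrix P Y
        * (pairingMatrix ι c * secondMomentMatrix P Y)).trace = c ^ 2 / 2 * ∑ k, ∑ l,
      ((∫ ω, Y (.inl k) ω * Y (.inl l) ω ∂P) * (∫ ω, Y (.inr k) ω * Y (.inr l) ω ∂P)
        + (∫ ω, Y (.inl k) ω * Y (.inr l) ω ∂P)
          * (∫ ω, Y (.inl l) ω * Y (.inr k) ω ∂P)) := by
  rw [pairingMatrix_mul, fromBlocks_multiply, trace_fromBlocks_eq]
  simp only [Matrix.trace, diag_apply, Matrix.add_apply, Matrix.mul_apply, Matrix.smul_apply,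
    smul_eq_mul]
  rw [← Finset.sum_add_distrib, Finset.mul_sum]
  refine Finset.sum_congr rfl fun k _ => ?_
  rw [← Finset.sum_add_distrib, ← Finset.sum_add_distrib, ← Finset.sum_add_distrib,
    Finset.mul_sum]
  refine Finset.sum_congr rfl fun l _ => ?_
  simp only [toBlocks₂₁, toBlocks₁₂, toBlocks₁₁, toBlocks₂₂, secondMomentMatrix, of_apply]
  rw [show (∫ ω, Y (.inr k) ω * Y (.inl l) ω ∂P) = ∫ ω, Y (.inl l) ω * Y (.inr k) ω ∂P by
      simp only [mul_comm],
    show (∫ ω, Y (.inr l) ω * Y (.inl k) ω ∂P) = ∫ ω, Y (.inl k) ω * Y (.inr l) ω ∂P by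
      simp only [mul_comm],
    show (∫ ω, Y (.inr l) ω * Y (.inr k) ω ∂P) = ∫ ω, Y (.inr k) ω * Y (.inr l) ω ∂P by
      simp only [mul_comm],
    show (∫ ω, Y (.inl l) ω * Y (.inl k) ω ∂P) = ∫ ω, Y (.inl k) ω * Y (.inl l) ω ∂P by
      simp only [mul_comm]]
  ring

/-- The Isserlis expression for the variance of `∑ₖ Uₖ Vₖ` is nonnegative, being twice the trace
of the square of a symmetric matrix. -/
lemma sum_sum_isserlis_nonneg {Y : ι ⊕ ι → Ω → ℝ} (hY : ∀ i, MemLp (Y i) 2 P) :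
    0 ≤ ∑ k, ∑ l,
      ((∫ ω, Y (.inl k) ω * Y (.inl l) ω ∂P) * (∫ ω, Y (.inr k) ω * Y (.inr l) ω ∂P)
        + (∫ ω, Y (.inl k) ω * Y (.inr l) ω ∂P)
          * (∫ ω, Y (.inl l) ω * Y (.inr k) ω ∂P)) := by
  have h := trace_sq_mul_nonneg (posSemidef_secondMomentMatrix hY) (transpose_pairingMatrix 1)
  rw [trace_sq_pairingMatrix_mul_secondMomentMatrix] at h
  linarith

/-- Laplace transform of a centered sum of products `∑ₖ Uₖ Vₖ` of jointly Gaussian variables; the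
hypothesis bounds `2 c²` times the variance of that sum, as given by the Isserlis formula. -/
lemma lintegral_exp_sum_mul_le [IsProbabilityMeasure P] {Y : ι ⊕ ι → Ω → ℝ}
    (hY : HasGaussianLaw (fun ω i => Y i ω) P) (hmean : ∀ i, ∫ ω, Y i ω ∂P = 0)
    {c s : ℝ} (hs0 : 0 < s) (hs : s < 1)
    (hvar : 2 * c ^ 2 * ∑ k, ∑ l,
      ((∫ ω, Y (.inl k) ω * Y (.inl l) ω ∂P) * (∫ ω, Y (.inr k) ω * Y (.inr l) ω ∂P)
        + (∫ ω, Y (.inl k) ω * Y (.inr l) ω ∂P) * (∫ ω, Y (.inl l) ω * Y (.inr k) ω ∂P)) ≤ s ^ 2) :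
    ∫⁻ ω, ENNReal.ofReal (Real.exp (c * ∑ k, (Y (.inl k) ω * Y (.inr k) ω
        - ∫ ω', Y (.inl k) ω' * Y (.inr k) ω' ∂P))) ∂P
      ≤ ENNReal.ofReal (sqGaussianBound s) := by
  have key := lintegral_exp_quadraticForm_le hY hmean (transpose_pairingMatrix c) hs0 hs (by
    rw [trace_sq_pairingMatrix_mul_secondMomentMatrix]
    linarith)
  refine le_trans (le_of_eq ?_) key
  refine lintegral_congr fun ω => ?_
  rw [trace_pairingMatrix_mul_secondMomentMatrix, Finset.sum_sub_distrib, mul_sub]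
  congr 3
  simp only [pairingMatrix, dotProduct, Fintype.sum_sum_type, fromBlocks_mulVec]
  simp only [Function.comp_def, zero_mulVec, smul_mulVec, one_mulVec, zero_add, add_zero,
    Sum.elim_inl, Sum.elim_inr, Pi.smul_apply, smul_eq_mul]
  rw [← Finset.sum_add_distrib, Finset.mul_sum]
  exact Finset.sum_congr rfl fun k _ => by ring

end FiniteDimensional

lemma ProbabilityTheory.IsGaussianProcess.hasGaussianLaw_of_fintype {S ι Ω : Type*} [Fintype ι]
    [MeasurableSpace Ω] {P : Measure Ω} {X : S → Ω → ℝ} (hX : IsGaussianProcess X P) (f : ι → S) :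
    HasGaussianLaw (fun ω i => X (f i) ω) P := by
  let L : ({i : ι // i ∈ (Finset.univ : Finset ι)} → ℝ) →L[ℝ] (ι → ℝ) :=
    { toFun := fun x i => x ⟨i, Finset.mem_univ i⟩
      map_add' := fun x y => rfl
      map_smul' := fun m x => rfl }
  exact ((hX.comp_right f).hasGaussianLaw Finset.univ).map L

/-! ### Riemann sums on a uniform partition -/

/-- The right end point of the interval of the partition of `[0, T]` into `n` equal parts that
contains `t`. Right end points are taken because interval integrals live on left-open intervals,
on which this function is then constant. -/
noncomputable def gridPoint (T : ℝ) (n : ℕ) (t : ℝ) : ℝ := ⌈n * t / T⌉₊ * (T / n)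

lemma measurable_gridPoint (T : ℝ) (n : ℕ) : Measurable (gridPoint T n) := by
  unfold gridPoint
  fun_prop

lemma gridPoint_eq {T : ℝ} (hT : 0 < T) {n : ℕ} (hn : n ≠ 0) {k : ℕ} {t : ℝ}
    (ht : t ∈ Set.Ioc (k * (T / n)) ((k + 1 : ℕ) * (T / n))) :
    gridPoint T n t = (k + 1 : ℕ) * (T / n) := by
  have hn' : (0 : ℝ) < n := by positivity
  have hTn : (0 : ℝ) < T / n := by positivity
  have h : n * t / T = t / (T / n) := by field_simp
  rw [gridPoint, h, (Nat.ceil_eq_iff (Nat.succ_ne_zero k)).2]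
  rw [lt_div_iff₀ hTn, div_le_iff₀ hTn]
  exact ht

lemma abs_gridPoint_sub_le {T : ℝ} (hT : 0 < T) {n : ℕ} (hn : n ≠ 0) {t : ℝ} (ht : 0 ≤ t) :
    |gridPoint T n t - t| ≤ T / n := by
  have hn' : (0 : ℝ) < n := by positivity
  have hTn : (0 : ℝ) < T / n := by positivity
  have h : n * t / T = t / (T / n) := by field_simp
  have h0 : 0 ≤ t / (T / n) := by positivity
  have h1 := Nat.le_ceil (t / (T / n))
  have h2 := (Nat.ceil_lt_add_one h0).le
  rw [div_le_iff₀ hTn] at h1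
  rw [gridPoint, h, abs_le]
  constructor
  · linarith
  · have h3 := mul_le_mul_of_nonneg_right h2 hTn.le
    rw [add_mul, div_mul_cancel₀ _ hTn.ne'] at h3
    linarith

lemma gridPoint_mem_Icc {T : ℝ} (hT : 0 < T) {n : ℕ} (hn : n ≠ 0) {t : ℝ}
    (ht : t ∈ Set.Ioc 0 T) : gridPoint T n t ∈ Set.Icc 0 T := by
  have hn' : (0 : ℝ) < n := by positivity
  have hTn : (0 : ℝ) < T / n := by positivity
  refine ⟨by unfold gridPoint; positivity, ?_⟩
  have h : ⌈n * t / T⌉₊ ≤ n := by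
    rw [Nat.ceil_le, div_le_iff₀ hT]
    exact mul_le_mul_of_nonneg_left ht.2 hn'.le
  have h' : (⌈n * t / T⌉₊ : ℝ) ≤ n := by exact_mod_cast h
  calc gridPoint T n t ≤ n * (T / n) := mul_le_mul_of_nonneg_right h' hTn.le
    _ = T := by field_simp

lemma tendsto_gridPoint {T : ℝ} (hT : 0 < T) {t : ℝ} (ht : 0 ≤ t) :
    Tendsto (fun n => gridPoint T n t) atTop (𝓝 t) := by
  rw [tendsto_iff_dist_tendsto_zero]
  refine squeeze_zero' (.of_forall fun n => dist_nonneg) ?_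
    (tendsto_const_div_atTop_nhds_zero_nat T)
  filter_upwards [eventually_ne_atTop 0] with n hn
  exact abs_gridPoint_sub_le hT hn ht

lemma intervalIntegral_gridPoint {T : ℝ} (hT : 0 < T) {n : ℕ} (hn : n ≠ 0) (f : ℝ → ℝ) :
    IntervalIntegrable (fun t => f (gridPoint T n t)) volume 0 T ∧
      ∫ t in (0 : ℝ)..T, f (gridPoint T n t)
        = T / n * ∑ k ∈ Finset.range n, f ((k + 1 : ℕ) * (T / n)) := by
  have hTn : (0 : ℝ) < T / n := by positivity
  let a : ℕ → ℝ := fun k => k * (T / n)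
  have ha0 : a 0 = 0 := by simp [a]
  have han : a n = T := by simp only [a]; field_simp
  have hle : ∀ k, a k ≤ a (k + 1) := fun k => by
    simp only [a]
    gcongr
    exact Nat.le_succ k
  have heq : ∀ k, Set.EqOn (fun _ => f ((k + 1 : ℕ) * (T / n)))
      (fun t => f (gridPoint T n t)) (Set.uIoc (a k) (a (k + 1))) := by
    intro k t ht
    rw [Set.uIoc_of_le (hle k)] at ht
    simp only [gridPoint_eq hT hn ht]
  have hint : ∀ k, IntervalIntegrable (fun t => f (gridPoint T n t)) volume (a k) (a (k + 1)) :=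
    fun k => IntervalIntegrable.congr (heq k) intervalIntegrable_const
  refine ⟨?_, ?_⟩
  · have := IntervalIntegrable.trans_iterate (n := n) fun k _ => hint k
    rwa [ha0, han] at this
  · have := intervalIntegral.sum_integral_adjacent_intervals (n := n) fun k _ => hint k
    rw [ha0, han] at this
    rw [← this, Finset.mul_sum]
    refine Finset.sum_congr rfl fun k _ => ?_
    rw [← intervalIntegral.integral_congr_ae (ae_of_all _ fun t ht => heq k ht)]
    rw [intervalIntegral.integral_const, smul_eq_mul]
    congr 1
    simp only [a]
    push_cast
    ring

/-- Bounded convergence for integrals over `[0, T]`. -/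
lemma tendsto_intervalIntegral_of_bounded {T C : ℝ} (hT : 0 < T) {F : ℕ → ℝ → ℝ} {f : ℝ → ℝ}
    (hm : ∀ n, Measurable (F n)) (hC : ∀ᶠ n in atTop, ∀ t ∈ Set.Ioc 0 T, |F n t| ≤ C)
    (hlim : ∀ t ∈ Set.Ioc 0 T, Tendsto (fun n => F n t) atTop (𝓝 (f t))) :
    Tendsto (fun n => ∫ t in (0 : ℝ)..T, F n t) atTop (𝓝 (∫ t in (0 : ℝ)..T, f t)) := by
  refine intervalIntegral.tendsto_integral_filter_of_dominated_convergence (fun _ => C)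
    (.of_forall fun n => (hm n).aestronglyMeasurable) ?_ intervalIntegrable_const ?_
  · filter_upwards [hC] with n hn
    exact ae_of_all _ fun t ht => hn t (by rwa [Set.uIoc_of_le hT.le] at ht)
  · exact ae_of_all _ fun t ht => hlim t (by rwa [Set.uIoc_of_le hT.le] at ht)

lemma exists_bound_on_square {H : ℝ × ℝ → ℝ} (hH : Continuous H) (T : ℝ) :
    ∃ C, 0 ≤ C ∧ ∀ t ∈ Set.Icc 0 T, ∀ s ∈ Set.Icc 0 T, |H (t, s)| ≤ C := by
  obtain ⟨C, hC⟩ := (isCompact_Icc.prod isCompact_Icc :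
    IsCompact (Set.Icc (0 : ℝ) T ×ˢ Set.Icc (0 : ℝ) T)).exists_bound_of_continuousOn
      hH.continuousOn
  exact ⟨max C 0, le_max_right _ _, fun t ht s hs => (hC (t, s) ⟨ht, hs⟩).trans (le_max_left _ _)⟩

lemma tendsto_integral_gridPoint_diag {T : ℝ} (hT : 0 < T) {G : ℝ × ℝ → ℝ} (hG : Continuous G) :
    Tendsto (fun n => ∫ t in (0 : ℝ)..T, G (gridPoint T n t, t)) atTop
      (𝓝 (∫ t in (0 : ℝ)..T, G (t, t))) := by
  obtain ⟨C, -, hC⟩ := exists_bound_on_square hG T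
  refine tendsto_intervalIntegral_of_bounded (C := C) hT (fun n => ?_) ?_ fun t ht => ?_
  · exact hG.measurable.comp ((measurable_gridPoint T n).prodMk measurable_id)
  · filter_upwards [eventually_ne_atTop 0] with n hn t ht
    exact hC _ (gridPoint_mem_Icc hT hn ht) _ (Set.Ioc_subset_Icc_self ht)
  · exact (hG.tendsto (t, t)).comp
      ((tendsto_gridPoint hT ht.1.le).prodMk_nhds tendsto_const_nhds)

lemma tendsto_integral_integral_gridPoint {T : ℝ} (hT : 0 < T) {H : ℝ × ℝ → ℝ}
    (hH : Continuous H) :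
    Tendsto (fun n => ∫ t in (0 : ℝ)..T, ∫ s in (0 : ℝ)..T, H (gridPoint T n t, gridPoint T n s))
      atTop (𝓝 (∫ t in (0 : ℝ)..T, ∫ s in (0 : ℝ)..T, H (t, s))) := by
  obtain ⟨C, hC0, hC⟩ := exists_bound_on_square hH T
  refine tendsto_intervalIntegral_of_bounded (C := C * T) hT (fun n => ?_) ?_ fun t ht => ?_
  · rcases eq_or_ne n 0 with rfl | hn
    · simp [gridPoint]
    · simp only [fun t => (intervalIntegral_gridPoint hT hn (fun s => H (gridPoint T n t, s))).2]
      refine Measurable.const_mul (Finset.measurable_sum _ fun k _ => ?_) _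
      exact hH.measurable.comp ((measurable_gridPoint T n).prodMk measurable_const)
  · filter_upwards [eventually_ne_atTop 0] with n hn t ht
    have := intervalIntegral.norm_integral_le_of_norm_le_const (a := 0) (b := T) (C := C)
      (f := fun s => H (gridPoint T n t, gridPoint T n s)) (fun s hs => by
        rw [Set.uIoc_of_le hT.le] at hs
        exact hC _ (gridPoint_mem_Icc hT hn ht) _ (gridPoint_mem_Icc hT hn hs))
    rwa [sub_zero, abs_of_pos hT] at this
  · refine tendsto_intervalIntegral_of_bounded (C := C) hT (fun n => ?_) ?_ fun s hs => ?_
    · exact hH.measurable.comp (measurable_const.prodMk (measurable_gridPoint T n))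
    · filter_upwards [eventually_ne_atTop 0] with n hn s hs
      exact hC _ (gridPoint_mem_Icc hT hn ht) _ (gridPoint_mem_Icc hT hn hs)
    · exact (hH.tendsto (t, s)).comp
        ((tendsto_gridPoint hT ht.1.le).prodMk_nhds (tendsto_gridPoint hT hs.1.le))

/-! ### Gaussian processes with continuous covariance -/

/-- A jointly measurable centered Gaussian process on the whole line whose covariance kernel
`(t, s) ↦ E X(t) X(s)` is continuous. -/
structure IsContinuousCovGaussian {Ω : Type*} [MeasurableSpace Ω] (X : ℝ → Ω → ℝ)
    (P : Measure Ω) : Prop where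
  measurable : Measurable (Function.uncurry X)
  gaussian : IsGaussianProcess X P
  centered : ∀ t, ∫ ω, X t ω ∂P = 0
  continuous_cov : Continuous fun q : ℝ × ℝ => ∫ ω, X q.1 ω * X q.2 ω ∂P

/-- The covariance kernel `E X(t) X(s)` of a centered process. -/
noncomputable def covKernel {Ω : Type*} [MeasurableSpace Ω] (X : ℝ → Ω → ℝ) (P : Measure Ω)
    (t s : ℝ) : ℝ := ∫ ω, X t ω * X s ω ∂P

/-- The expectation of the correlogram. -/
noncomputable def correlogramMean {Ω : Type*} [MeasurableSpace Ω] (X : ℝ → Ω → ℝ) (P : Measure Ω)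
    (T τ : ℝ) : ℝ := (1 / T) * ∫ t in (0 : ℝ)..T, covKernel X P (t + τ) t

/-- The covariance of `X(t+τ) X(t)` and `X(s+τ) X(s)`, given by the Isserlis formula. -/
noncomputable def productCov {Ω : Type*} [MeasurableSpace Ω] (X : ℝ → Ω → ℝ) (P : Measure Ω)
    (τ : ℝ) (q : ℝ × ℝ) : ℝ :=
  covKernel X P (q.1 + τ) (q.2 + τ) * covKernel X P q.1 q.2
    + covKernel X P (q.1 + τ) q.2 * covKernel X P (q.2 + τ) q.1

/-- The variance of the correlogram, as the integral of the Isserlis covariance `productCov`. -/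
noncomputable def correlogramVar {Ω : Type*} [MeasurableSpace Ω] (X : ℝ → Ω → ℝ) (P : Measure Ω)
    (T τ : ℝ) : ℝ := (1 / T ^ 2) * ∫ t in (0 : ℝ)..T, ∫ s in (0 : ℝ)..T, productCov X P τ (t, s)

/-- The Cauchy–Schwarz inequality for square integrable random variables. -/
lemma integral_abs_mul_le_sqrt {Ω : Type*} [MeasurableSpace Ω] {P : Measure Ω} {f g : Ω → ℝ}
    (hf : MemLp f 2 P) (hg : MemLp g 2 P) :
    ∫ ω, |f ω * g ω| ∂P ≤ √(∫ ω, f ω * f ω ∂P) * √(∫ ω, g ω * g ω ∂P) := by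
  have h := integral_mul_norm_le_Lp_mul_Lq (μ := P) (f := f) (g := g)
    Real.HolderConjugate.two_two (by simpa using hf) (by simpa using hg)
  simp only [Real.norm_eq_abs, ← abs_mul, ← Real.sqrt_eq_rpow] at h
  refine h.trans (le_of_eq ?_)
  congr 2 <;> refine integral_congr_ae (ae_of_all _ fun ω => ?_) <;>
    simp [sq]

namespace IsContinuousCovGaussian

variable {Ω : Type*} [MeasurableSpace Ω] {P : Measure Ω} {X : ℝ → Ω → ℝ}

lemma continuous_covKernel (hX : IsContinuousCovGaussian X P) {f g : ℝ × ℝ → ℝ}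
    (hf : Continuous f) (hg : Continuous g) : Continuous fun q => covKernel X P (f q) (g q) :=
  hX.continuous_cov.comp (hf.prodMk hg)

lemma memLp_two (hX : IsContinuousCovGaussian X P) (t : ℝ) : MemLp (X t) 2 P :=
  (hX.gaussian.hasGaussianLaw_eval t).memLp_two

lemma measurable_eval (hX : IsContinuousCovGaussian X P) (t : ℝ) : Measurable (X t) :=
  hX.measurable.comp measurable_prodMk_left

lemma integrable_mul (hX : IsContinuousCovGaussian X P) (t s : ℝ) :
    Integrable (fun ω => X t ω * X s ω) P := (hX.memLp_two t).integrable_mul (hX.memLp_two s)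

lemma continuous_productCov (hX : IsContinuousCovGaussian X P) :
    Continuous fun q : ℝ × (ℝ × ℝ) => productCov X P q.1 q.2 := by
  have h := hX.continuous_cov
  have key : ∀ f g : ℝ × (ℝ × ℝ) → ℝ, Continuous f → Continuous g →
      Continuous fun q => covKernel X P (f q) (g q) := fun f g hf hg => h.comp (hf.prodMk hg)
  unfold productCov
  exact ((key _ _ (by fun_prop) (by fun_prop)).mul (key _ _ (by fun_prop) (by fun_prop))).add
    ((key _ _ (by fun_prop) (by fun_prop)).mul (key _ _ (by fun_prop) (by fun_prop)))

/-- The squared `L²` distance `E (X(t) - X(s))²`, in terms of the covariance kernel. -/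
lemma integral_sub_mul_sub (hX : IsContinuousCovGaussian X P) (t s : ℝ) :
    ∫ ω, (X t ω - X s ω) * (X t ω - X s ω) ∂P
      = covKernel X P t t - 2 * covKernel X P t s + covKernel X P s s := by
  have e : ∀ ω, (X t ω - X s ω) * (X t ω - X s ω)
      = (X t ω * X t ω - 2 * (X t ω * X s ω)) + X s ω * X s ω := fun ω => by ring
  simp only [e]
  rw [integral_add _ (hX.integrable_mul s s), integral_sub (hX.integrable_mul t t),
    integral_const_mul]
  · rfl
  · exact (hX.integrable_mul t s).const_mul 2
  · exact (hX.integrable_mul t t).sub ((hX.integrable_mul t s).const_mul 2)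

end IsContinuousCovGaussian

/-- A continuous bound, vanishing on the diagonal, for the `L¹` distance between the centered
products `X(u+τ) X(u) - E X(u+τ) X(u)` at two times. -/
noncomputable def productModulus {Ω : Type*} [MeasurableSpace Ω] (X : ℝ → Ω → ℝ) (P : Measure Ω)
    (τ : ℝ) (q : ℝ × ℝ) : ℝ :=
  √(covKernel X P (q.1 + τ) (q.1 + τ) - 2 * covKernel X P (q.1 + τ) (q.2 + τ)
      + covKernel X P (q.2 + τ) (q.2 + τ)) * √(covKernel X P q.1 q.1)
    + √(covKernel X P (q.2 + τ) (q.2 + τ)) * √(covKernel X P q.1 q.1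
      - 2 * covKernel X P q.1 q.2 + covKernel X P q.2 q.2)
    + |covKernel X P (q.1 + τ) q.1 - covKernel X P (q.2 + τ) q.2|

namespace IsContinuousCovGaussian

variable {Ω : Type*} [MeasurableSpace Ω] {P : Measure Ω} {X : ℝ → Ω → ℝ}

lemma continuous_productModulus (hX : IsContinuousCovGaussian X P) (τ : ℝ) :
    Continuous (productModulus X P τ) := by
  have key : ∀ f g : ℝ × ℝ → ℝ, Continuous f → Continuous g →
      Continuous fun q => covKernel X P (f q) (g q) := fun f g => hX.continuous_covKernel
  have h1 := key (fun q => q.1 + τ) (fun q => q.1 + τ) (by fun_prop) (by fun_prop)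
  have h2 := key (fun q => q.1 + τ) (fun q => q.2 + τ) (by fun_prop) (by fun_prop)
  have h3 := key (fun q => q.2 + τ) (fun q => q.2 + τ) (by fun_prop) (by fun_prop)
  have h4 := key (fun q => q.1) (fun q => q.1) (by fun_prop) (by fun_prop)
  have h5 := key (fun q => q.1) (fun q => q.2) (by fun_prop) (by fun_prop)
  have h6 := key (fun q => q.2) (fun q => q.2) (by fun_prop) (by fun_prop)
  have h7 := key (fun q => q.1 + τ) (fun q => q.1) (by fun_prop) (by fun_prop)
  have h8 := key (fun q => q.2 + τ) (fun q => q.2) (by fun_prop) (by fun_prop)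
  unfold productModulus
  fun_prop

lemma productModulus_self (τ t : ℝ) : productModulus X P τ (t, t) = 0 := by
  have h : ∀ x : ℝ, x - 2 * x + x = 0 := fun x => by ring
  simp [productModulus, h]

lemma productModulus_nonneg (τ : ℝ) (q : ℝ × ℝ) : 0 ≤ productModulus X P τ q := by
  unfold productModulus
  positivity

lemma lintegral_enorm_sub_le [IsProbabilityMeasure P] (hX : IsContinuousCovGaussian X P)
    (τ u t : ℝ) :
    ∫⁻ ω, ‖(X (u + τ) ω * X u ω - covKernel X P (u + τ) u)
        - (X (t + τ) ω * X t ω - covKernel X P (t + τ) t)‖ₑ ∂P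
      ≤ ENNReal.ofReal (productModulus X P τ (u, t)) := by
  have i1 : Integrable (fun ω => |(X (u + τ) ω - X (t + τ) ω) * X u ω|) P :=
    (((hX.memLp_two _).sub (hX.memLp_two _)).integrable_mul (hX.memLp_two _)).abs
  have i2 : Integrable (fun ω => |X (t + τ) ω * (X u ω - X t ω)|) P :=
    ((hX.memLp_two _).integrable_mul ((hX.memLp_two _).sub (hX.memLp_two _))).abs
  have i3 : Integrable (fun _ : Ω => |covKernel X P (u + τ) u - covKernel X P (t + τ) t|) P :=
    integrable_const _
  have i12 : Integrable (fun ω => |(X (u + τ) ω - X (t + τ) ω) * X u ω|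
      + |X (t + τ) ω * (X u ω - X t ω)|) P := i1.add i2
  have c1 := integral_abs_mul_le_sqrt ((hX.memLp_two (u + τ)).sub (hX.memLp_two (t + τ)))
    (hX.memLp_two u)
  have c2 := integral_abs_mul_le_sqrt (hX.memLp_two (t + τ))
    ((hX.memLp_two u).sub (hX.memLp_two t))
  simp only [Pi.sub_apply, hX.integral_sub_mul_sub] at c1 c2
  calc _ ≤ ∫⁻ ω, ENNReal.ofReal (|(X (u + τ) ω - X (t + τ) ω) * X u ω|
          + |X (t + τ) ω * (X u ω - X t ω)|
          + |covKernel X P (u + τ) u - covKernel X P (t + τ) t|) ∂P := by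
        refine lintegral_mono fun ω => ?_
        rw [Real.enorm_eq_ofReal_abs]
        refine ENNReal.ofReal_le_ofReal ?_
        have e : (X (u + τ) ω * X u ω - covKernel X P (u + τ) u)
            - (X (t + τ) ω * X t ω - covKernel X P (t + τ) t)
            = (X (u + τ) ω - X (t + τ) ω) * X u ω + X (t + τ) ω * (X u ω - X t ω)
              - (covKernel X P (u + τ) u - covKernel X P (t + τ) t) := by ring
        rw [e]
        exact (abs_sub _ _).trans (add_le_add_left (abs_add_le _ _) _)
    _ = ENNReal.ofReal (∫ ω, (|(X (u + τ) ω - X (t + τ) ω) * X u ω|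
          + |X (t + τ) ω * (X u ω - X t ω)|
          + |covKernel X P (u + τ) u - covKernel X P (t + τ) t|) ∂P) :=
        (ofReal_integral_eq_lintegral_ofReal (i12.add i3)
          (ae_of_all _ fun ω => add_nonneg (add_nonneg (abs_nonneg _) (abs_nonneg _))
            (abs_nonneg _))).symm
    _ ≤ _ := by
        refine ENNReal.ofReal_le_ofReal ?_
        rw [integral_add i12 i3, integral_add i1 i2, integral_const]
        simp only [probReal_univ, one_smul]
        exact add_le_add_left (add_le_add c1 c2) _

lemma measurable_uncurry_mul_sub (hX : IsContinuousCovGaussian X P) (τ : ℝ) :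
    Measurable fun q : ℝ × Ω => X (q.1 + τ) q.2 * X q.1 q.2 - covKernel X P (q.1 + τ) q.1 := by
  have h1 : Measurable fun q : ℝ × Ω => X (q.1 + τ) q.2 :=
    hX.measurable.comp ((measurable_fst.add_const τ).prodMk measurable_snd)
  have h2 : Measurable fun q : ℝ × Ω => X q.1 q.2 := hX.measurable
  have h3 : Continuous fun t : ℝ => covKernel X P (t + τ) t :=
    hX.continuous_cov.comp (by fun_prop : Continuous fun t : ℝ => (t + τ, t))
  exact (h1.mul h2).sub (h3.measurable.comp measurable_fst)

lemma continuous_covKernel_shift (hX : IsContinuousCovGaussian X P) (τ : ℝ) :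
    Continuous fun t : ℝ => covKernel X P (t + τ) t :=
  hX.continuous_cov.comp (by fun_prop : Continuous fun t : ℝ => (t + τ, t))

/-- Almost every path is square integrable on bounded intervals. -/
lemma ae_integrableOn_sq [IsProbabilityMeasure P] (hX : IsContinuousCovGaussian X P) (a b : ℝ) :
    ∀ᵐ ω ∂P, IntegrableOn (fun t => X t ω * X t ω) (Set.Icc a b) volume := by
  have hm : Measurable fun q : Ω × ℝ => X q.2 q.1 * X q.2 q.1 :=
    (hX.measurable.comp measurable_swap).mul (hX.measurable.comp measurable_swap)
  have hm' : Measurable fun q : ℝ × Ω => X q.1 q.2 * X q.1 q.2 :=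
    hX.measurable.mul hX.measurable
  have hint : Integrable (fun q : ℝ × Ω => X q.1 q.2 * X q.1 q.2)
      ((volume.restrict (Set.Icc a b)).prod P) := by
    rw [integrable_prod_iff hm'.aestronglyMeasurable]
    refine ⟨ae_of_all _ fun t => hX.integrable_mul t t, ?_⟩
    have : ∀ t, ∫ ω, ‖X t ω * X t ω‖ ∂P = covKernel X P t t := fun t =>
      integral_congr_ae (ae_of_all _ fun ω => by
        simp only [Real.norm_eq_abs, abs_mul_abs_self, abs_mul])
    simp only [this]
    have hc : Continuous fun t : ℝ => covKernel X P t t :=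
      hX.continuous_cov.comp (by fun_prop : Continuous fun t : ℝ => (t, t))
    exact hc.continuousOn.integrableOn_compact isCompact_Icc
  exact hint.prod_left_ae

/-- For almost every path the correlogram integral converges for all lags in a bounded interval. -/
lemma ae_intervalIntegrable_mul [IsProbabilityMeasure P] (hX : IsContinuousCovGaussian X P)
    {T : ℝ} (hT : 0 < T) (a b : ℝ) :
    ∀ᵐ ω ∂P, ∀ τ ∈ Set.Icc a b,
      IntervalIntegrable (fun t => X (t + τ) ω * X t ω) volume 0 T := by
  filter_upwards [hX.ae_integrableOn_sq a (T + b), hX.ae_integrableOn_sq 0 T] with ω h1 h2 τ hτ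
  rw [intervalIntegrable_iff_integrableOn_Icc_of_le hT.le]
  have hmX : Measurable fun t => X t ω := hX.measurable.comp measurable_prodMk_right
  have h3 : IntegrableOn (fun t => X (t + τ) ω * X (t + τ) ω) (Set.Icc 0 T) volume := by
    have := (measurePreserving_add_right volume τ).integrableOn_comp_preimage
      (measurableEmbedding_addRight τ) (f := fun t => X t ω * X t ω) (s := Set.Icc τ (T + τ))
    have hs : (fun x : ℝ => x + τ) ⁻¹' Set.Icc τ (T + τ) = Set.Icc 0 T := by
      ext x
      simp
    rw [hs] at this
    refine this.2 (h1.mono_set ?_)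
    exact Set.Icc_subset_Icc hτ.1 (by linarith [hτ.2])
  refine Integrable.mono' (h3.add h2)
    ((hmX.comp (measurable_add_const τ)).mul hmX).aestronglyMeasurable (ae_of_all _ fun t => ?_)
  simp only [Pi.add_apply, Real.norm_eq_abs, abs_mul]
  nlinarith [sq_nonneg (|X (t + τ) ω| - |X t ω|), abs_mul_abs_self (X (t + τ) ω),
    abs_mul_abs_self (X t ω), abs_nonneg (X (t + τ) ω), abs_nonneg (X t ω)]

end IsContinuousCovGaussian

/-! ### Laplace transform of the centered correlogram -/

/-- The Riemann sum of the centered correlogram over the partition of `[0, T]` into `n` equal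
parts. -/
noncomputable def riemannDeviation {Ω : Type*} [MeasurableSpace Ω] (X : ℝ → Ω → ℝ) (P : Measure Ω)
    (T τ : ℝ) (n : ℕ) (ω : Ω) : ℝ :=
  (1 / n) * ∑ k : Fin n, (X ((k + 1 : ℕ) * (T / n) + τ) ω * X ((k + 1 : ℕ) * (T / n)) ω
    - covKernel X P ((k + 1 : ℕ) * (T / n) + τ) ((k + 1 : ℕ) * (T / n)))

namespace IsContinuousCovGaussian

variable {Ω : Type*} [MeasurableSpace Ω] {P : Measure Ω} {X : ℝ → Ω → ℝ}

lemma riemannDeviation_eq {T : ℝ} (hT : 0 < T) (τ : ℝ) {n : ℕ} (hn : n ≠ 0) (ω : Ω) :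
    riemannDeviation X P T τ n ω = (1 / T) * ∫ t in (0 : ℝ)..T,
      (X (gridPoint T n t + τ) ω * X (gridPoint T n t) ω
        - covKernel X P (gridPoint T n t + τ) (gridPoint T n t)) := by
  have hn' : (0 : ℝ) < n := by positivity
  rw [(intervalIntegral_gridPoint hT hn
    (fun u => X (u + τ) ω * X u ω - covKernel X P (u + τ) u)).2, riemannDeviation,
    ← Fin.sum_univ_eq_sum_range
      (fun k : ℕ => X ((k + 1 : ℕ) * (T / n) + τ) ω * X ((k + 1 : ℕ) * (T / n)) ω
        - covKernel X P ((k + 1 : ℕ) * (T / n) + τ) ((k + 1 : ℕ) * (T / n))), ← mul_assoc]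
  congr 1
  field_simp

lemma measurable_riemannDeviation (hX : IsContinuousCovGaussian X P) (T τ : ℝ) (n : ℕ) :
    Measurable (riemannDeviation X P T τ n) := by
  unfold riemannDeviation
  exact (Finset.measurable_sum _ fun k _ =>
    ((hX.measurable_eval _).mul (hX.measurable_eval _)).sub_const _).const_mul _

lemma measurable_correlogram (hX : IsContinuousCovGaussian X P) (T : ℝ) :
    Measurable fun q : ℝ × Ω => correlogram X T q.1 q.2 := by
  have hm : StronglyMeasurable (Function.uncurry fun (q : ℝ × Ω) (t : ℝ) =>
      X (t + q.1) q.2 * X t q.2) := by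
    apply Measurable.stronglyMeasurable
    have h1 : Measurable fun r : (ℝ × Ω) × ℝ => X (r.2 + r.1.1) r.1.2 :=
      hX.measurable.comp (by fun_prop : Measurable fun r : (ℝ × Ω) × ℝ => (r.2 + r.1.1, r.1.2))
    have h2 : Measurable fun r : (ℝ × Ω) × ℝ => X r.2 r.1.2 :=
      hX.measurable.comp (by fun_prop : Measurable fun r : (ℝ × Ω) × ℝ => (r.2, r.1.2))
    exact h1.mul h2
  unfold correlogram intervalIntegral
  exact ((hm.integral_prod_right.sub hm.integral_prod_right).measurable).const_mul _

lemma measurable_correlogram_lag (hX : IsContinuousCovGaussian X P) (T τ : ℝ) :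
    Measurable (correlogram X T τ) :=
  (hX.measurable_correlogram T).comp measurable_prodMk_left

variable [IsProbabilityMeasure P]

lemma lintegral_enorm_riemannDeviation_sub_le (hX : IsContinuousCovGaussian X P) {T : ℝ}
    (hT : 0 < T) (τ : ℝ) {n : ℕ} (hn : n ≠ 0) :
    ∫⁻ ω, ‖riemannDeviation X P T τ n ω - (correlogram X T τ ω - correlogramMean X P T τ)‖ₑ ∂P
      ≤ ENNReal.ofReal ((1 / T) * ∫ t in (0 : ℝ)..T,
          productModulus X P τ (gridPoint T n t, t)) := by
  set Z : ℝ → Ω → ℝ := fun u ω => X (u + τ) ω * X u ω - covKernel X P (u + τ) u with hZ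
  have hZm : Measurable fun q : ℝ × Ω => Z q.1 q.2 := hX.measurable_uncurry_mul_sub τ
  have hgZ : Measurable fun q : Ω × ℝ => Z (gridPoint T n q.2) q.1 - Z q.2 q.1 :=
    (hZm.comp (((measurable_gridPoint T n).comp measurable_snd).prodMk measurable_fst)).sub
      (hZm.comp measurable_swap)
  have hGint : IntegrableOn (fun t => productModulus X P τ (gridPoint T n t, t))
      (Set.Ioc 0 T) volume := by
    obtain ⟨C, -, hC⟩ := exists_bound_on_square (hX.continuous_productModulus τ) T
    refine Measure.integrableOn_of_bounded (M := C) measure_Ioc_lt_top.ne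
      ((hX.continuous_productModulus τ).measurable.comp
        ((measurable_gridPoint T n).prodMk measurable_id)).aestronglyMeasurable ?_
    refine (ae_restrict_iff' measurableSet_Ioc).2 (ae_of_all _ fun t ht => ?_)
    exact hC _ (gridPoint_mem_Icc hT hn ht) _ (Set.Ioc_subset_Icc_self ht)
  calc _ ≤ ∫⁻ ω, ENNReal.ofReal (1 / T)
          * (∫⁻ t in Set.Ioc 0 T, ‖Z (gridPoint T n t) ω - Z t ω‖ₑ) ∂P := by
        refine lintegral_mono_ae ?_
        filter_upwards [hX.ae_intervalIntegrable_mul hT τ τ] with ω hω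
        have h1 := hω τ ⟨le_rfl, le_rfl⟩
        have h2 := (hX.continuous_covKernel_shift τ).intervalIntegrable (μ := volume) 0 T
        have h3 : correlogram X T τ ω - correlogramMean X P T τ
            = (1 / T) * ∫ t in (0 : ℝ)..T, Z t ω := by
          rw [correlogram, correlogramMean, ← mul_sub, ← intervalIntegral.integral_sub h1 h2]
        rw [h3, riemannDeviation_eq hT τ hn, ← mul_sub, ← intervalIntegral.integral_sub
          (intervalIntegral_gridPoint hT hn fun u => Z u ω).1 (h1.sub h2), enorm_mul,
          Real.enorm_eq_ofReal (by positivity), intervalIntegral.integral_of_le hT.le]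
        exact mul_le_mul_right (enorm_integral_le_lintegral_enorm _) _
    _ = ENNReal.ofReal (1 / T) * ∫⁻ t in Set.Ioc 0 T,
          ∫⁻ ω, ‖Z (gridPoint T n t) ω - Z t ω‖ₑ ∂P := by
        rw [lintegral_const_mul _ hgZ.enorm.lintegral_prod_right',
          lintegral_lintegral_swap hgZ.enorm.aemeasurable]
    _ ≤ ENNReal.ofReal (1 / T) * ∫⁻ t in Set.Ioc 0 T,
          ENNReal.ofReal (productModulus X P τ (gridPoint T n t, t)) := by
        gcongr with t
        exact hX.lintegral_enorm_sub_le τ _ _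
    _ = _ := by
        rw [ENNReal.ofReal_mul (by positivity), intervalIntegral.integral_of_le hT.le,
          ofReal_integral_eq_lintegral_ofReal hGint
            (ae_of_all _ fun t => productModulus_nonneg τ _)]

lemma tendstoInMeasure_riemannDeviation (hX : IsContinuousCovGaussian X P) {T : ℝ}
    (hT : 0 < T) (τ : ℝ) :
    TendstoInMeasure P (riemannDeviation X P T τ) atTop
      (fun ω => correlogram X T τ ω - correlogramMean X P T τ) := by
  refine tendstoInMeasure_of_tendsto_eLpNorm one_ne_zero
    (fun n => (hX.measurable_riemannDeviation T τ n).aestronglyMeasurable)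
    ((hX.measurable_correlogram_lag T τ).sub_const _).aestronglyMeasurable ?_
  have h := ((tendsto_integral_gridPoint_diag hT
    (hX.continuous_productModulus τ)).const_mul (1 / T))
  simp only [productModulus_self, intervalIntegral.integral_zero, mul_zero] at h
  have h' := ENNReal.tendsto_ofReal h
  rw [ENNReal.ofReal_zero] at h'
  refine tendsto_of_tendsto_of_tendsto_of_le_of_le' tendsto_const_nhds h'
    (.of_forall fun n => zero_le) ?_
  filter_upwards [eventually_ne_atTop 0] with n hn
  rw [eLpNorm_one_eq_lintegral_enorm]
  exact hX.lintegral_enorm_riemannDeviation_sub_le hT τ hn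

omit [IsProbabilityMeasure P] in
/-- The variances of the Riemann sums, computed by the Isserlis formula, converge to the variance
of the correlogram. -/
lemma tendsto_riemannVar (hX : IsContinuousCovGaussian X P) {T : ℝ} (hT : 0 < T) (τ : ℝ) :
    Tendsto (fun n : ℕ => (1 / (n : ℝ)) ^ 2 * ∑ k : Fin n, ∑ l : Fin n,
        productCov X P τ ((k + 1 : ℕ) * (T / n), (l + 1 : ℕ) * (T / n)))
      atTop (𝓝 (correlogramVar X P T τ)) := by
  have hH : Continuous (productCov X P τ) :=
    hX.continuous_productCov.comp (by fun_prop : Continuous fun q : ℝ × ℝ => (τ, q))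
  refine ((tendsto_integral_integral_gridPoint hT hH).const_mul (1 / T ^ 2)).congr' ?_
  filter_upwards [eventually_ne_atTop 0] with n hn
  have hn' : (0 : ℝ) < n := by positivity
  simp only [fun t => (intervalIntegral_gridPoint hT hn
    (fun s => productCov X P τ (gridPoint T n t, s))).2]
  rw [(intervalIntegral_gridPoint hT hn (fun t => T / n * ∑ l ∈ Finset.range n,
    productCov X P τ (t, (l + 1 : ℕ) * (T / n)))).2, ← Finset.mul_sum, ← mul_assoc, ← mul_assoc,
    ← Fin.sum_univ_eq_sum_range (fun k : ℕ => ∑ l ∈ Finset.range n,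
      productCov X P τ ((k + 1 : ℕ) * (T / n), (l + 1 : ℕ) * (T / n)))]
  congr 1
  · field_simp
  · refine Finset.sum_congr rfl fun k _ => ?_
    rw [← Fin.sum_univ_eq_sum_range (fun l : ℕ =>
      productCov X P τ ((k + 1 : ℕ) * (T / n), (l + 1 : ℕ) * (T / n)))]

lemma lintegral_exp_riemannDeviation_le (hX : IsContinuousCovGaussian X P) (T τ : ℝ) (n : ℕ)
    {c s : ℝ} (hs0 : 0 < s) (hs : s < 1)
    (hvar : 2 * c ^ 2 * ((1 / (n : ℝ)) ^ 2 * ∑ k : Fin n, ∑ l : Fin n,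
        productCov X P τ ((k + 1 : ℕ) * (T / n), (l + 1 : ℕ) * (T / n))) ≤ s ^ 2) :
    ∫⁻ ω, ENNReal.ofReal (Real.exp (c * riemannDeviation X P T τ n ω)) ∂P
      ≤ ENNReal.ofReal (sqGaussianBound s) := by
  let f : Fin n ⊕ Fin n → ℝ :=
    Sum.elim (fun k => (k + 1 : ℕ) * (T / n) + τ) (fun k => (k + 1 : ℕ) * (T / n))
  have h := lintegral_exp_sum_mul_le (Y := fun i => X (f i)) (c := c * (1 / n))
    (hX.gaussian.hasGaussianLaw_of_fintype f) (fun i => hX.centered _) hs0 hs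
    (le_trans (le_of_eq ?_) hvar)
  · refine le_trans (le_of_eq (lintegral_congr fun ω => ?_)) h
    rw [riemannDeviation, ← mul_assoc]
    rfl
  · rw [mul_pow, ← mul_assoc, ← mul_assoc]
    rfl

/-- Laplace transform of the centered correlogram, as the limit of that of its Riemann sums. -/
lemma lintegral_exp_correlogram_sub_le (hX : IsContinuousCovGaussian X P) {T : ℝ} (hT : 0 < T)
    (τ : ℝ) {c s : ℝ} (hs0 : 0 < s) (hs : s < 1)
    (hvar : 2 * c ^ 2 * correlogramVar X P T τ ≤ s ^ 2) :
    ∫⁻ ω, ENNReal.ofReal (Real.exp (c * (correlogram X T τ ω - correlogramMean X P T τ))) ∂P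
      ≤ ENNReal.ofReal (sqGaussianBound s) := by
  -- first with a strict inequality, which the Riemann sums then satisfy from some index on
  have strict : ∀ r, 0 < r → r < 1 → 2 * c ^ 2 * correlogramVar X P T τ < r ^ 2 →
      ∫⁻ ω, ENNReal.ofReal (Real.exp (c * (correlogram X T τ ω - correlogramMean X P T τ))) ∂P
        ≤ ENNReal.ofReal (sqGaussianBound r) := by
    intro r hr0 hr hlt
    obtain ⟨ns, hns, hae⟩ := (hX.tendstoInMeasure_riemannDeviation hT τ).exists_seq_tendsto_ae
    have hev := (((hX.tendsto_riemannVar hT τ).const_mul (2 * c ^ 2)).comp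
      hns.tendsto_atTop).eventually_lt_const hlt
    have hcont : Continuous fun x : ℝ => ENNReal.ofReal (Real.exp (c * x)) :=
      ENNReal.continuous_ofReal.comp (by fun_prop)
    calc _ = ∫⁻ ω, liminf (fun i => ENNReal.ofReal
          (Real.exp (c * riemannDeviation X P T τ (ns i) ω))) atTop ∂P := by
          refine lintegral_congr_ae ?_
          filter_upwards [hae] with ω hω
          exact (((hcont.tendsto _).comp hω).liminf_eq).symm
      _ ≤ liminf (fun i => ∫⁻ ω, ENNReal.ofReal
          (Real.exp (c * riemannDeviation X P T τ (ns i) ω)) ∂P) atTop :=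
          lintegral_liminf_le fun i =>
            hcont.measurable.comp (hX.measurable_riemannDeviation T τ (ns i))
      _ ≤ _ := by
          refine liminf_le_of_frequently_le' (Eventually.frequently ?_)
          filter_upwards [hev] with i hi
          exact hX.lintegral_exp_riemannDeviation_le T τ (ns i) hr0 hr hi.le
  have hcont : ContinuousAt (fun r => ENNReal.ofReal (sqGaussianBound r)) s := by
    refine ENNReal.continuous_ofReal.continuousAt.comp ?_
    unfold sqGaussianBound
    have : √(1 - s) ≠ 0 := (Real.sqrt_pos.2 (by linarith)).ne'
    exact ContinuousAt.mul (ContinuousAt.inv₀ (by fun_prop) this) (by fun_prop)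
  refine ge_of_tendsto (hcont.tendsto.mono_left (nhdsWithin_le_nhds (s := Set.Ioi s))) ?_
  filter_upwards [Ioo_mem_nhdsGT hs] with r hr
  exact strict r (hs0.trans hr.1) hr.2 (hvar.trans_lt (by gcongr; exact hr.1))

end IsContinuousCovGaussian

/-! ### Moments and tails of the integrated deviation -/

lemma rpow_le_mul_exp {x q c : ℝ} (hx : 0 ≤ x) (hq : 0 < q) (hc : 0 < c) :
    x ^ q ≤ (q / c) ^ q * Real.exp (-q) * Real.exp (c * x) := by
  have h1 : c * x / q ≤ Real.exp (c * x / q - 1) := by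
    have := Real.add_one_le_exp (c * x / q - 1)
    linarith
  have h2 : (c * x / q) ^ q ≤ Real.exp (c * x / q - 1) ^ q :=
    Real.rpow_le_rpow (by positivity) h1 hq.le
  rw [← Real.exp_mul] at h2
  have e : x = q / c * (c * x / q) := by field_simp
  calc x ^ q = (q / c) ^ q * (c * x / q) ^ q := by
        rw [← Real.mul_rpow (by positivity) (by positivity), ← e]
    _ ≤ (q / c) ^ q * Real.exp ((c * x / q - 1) * q) := by gcongr
    _ = _ := by
        rw [mul_assoc, ← Real.exp_add]
        congr 2
        field_simp
        ring

lemma exp_mul_abs_le (c x : ℝ) :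
    Real.exp (c * |x|) ≤ Real.exp (c * x) + Real.exp (-c * x) := by
  rcases abs_choice x with h | h <;> rw [h]
  · linarith [Real.exp_pos (-c * x)]
  · rw [mul_neg, ← neg_mul]
    linarith [Real.exp_pos (c * x)]

/-- Minkowski's integral inequality, `‖∫ F(a, ·)^p da‖_{q/p} ≤ ∫ ‖F(a, ·)^p‖_{q/p} da`, with the
norms `‖F(a, ·)‖_q` replaced by upper bounds `K^{1/q} w(a)`. It follows from Hölder's
inequality with the weight `w`. -/
lemma lintegral_rpow_lintegral_rpow_le {α Ω : Type*} [MeasurableSpace α] [MeasurableSpace Ω]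
    {μ : Measure α} {P : Measure Ω} [SFinite μ] [SFinite P] {F : α → Ω → ℝ≥0∞} {w : α → ℝ≥0∞}
    (hF : Measurable (Function.uncurry F)) (hw : Measurable w) (hw_top : ∀ a, w a ≠ ∞)
    {p q : ℝ} (hp : 0 < p) (hpq : p ≤ q) {K : ℝ≥0∞}
    (hmom : ∀ᵐ a ∂μ, ∫⁻ ω, F a ω ^ q ∂P ≤ w a ^ q * K) :
    ∫⁻ ω, (∫⁻ a, F a ω ^ p ∂μ) ^ (q / p) ∂P ≤ K * (∫⁻ a, w a ^ p ∂μ) ^ (q / p) := by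
  have hq : 0 < q := hp.trans_le hpq
  have hFa : ∀ a, Measurable (F a) := fun a => hF.comp measurable_prodMk_left
  have hFω : ∀ ω, Measurable fun a => F a ω := fun ω => hF.comp measurable_prodMk_right
  have hFswap : Measurable fun r : Ω × α => F r.2 r.1 := hF.comp measurable_swap
  -- where the weight vanishes, so does `F`
  have hzero : ∀ᵐ ω ∂P, ∀ᵐ a ∂μ, w a = 0 → F a ω = 0 := by
    have hset : MeasurableSet {r : Ω × α | w r.2 = 0 → F r.2 r.1 = 0} :=
      (((hw.comp measurable_snd) (measurableSet_singleton 0)).compl.union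
        (hFswap (measurableSet_singleton 0))).congr (by
          ext r
          simp only [Set.mem_union, Set.mem_compl_iff, Set.mem_preimage, Set.mem_singleton_iff,
            Set.mem_ofPred_eq, Function.comp_apply]
          tauto)
    have hset' : MeasurableSet {r : α × Ω | w r.1 = 0 → F r.1 r.2 = 0} :=
      measurable_swap hset
    refine Measure.ae_ae_comm hset' |>.1 ?_
    filter_upwards [hmom] with a ha
    by_cases h0 : w a = 0
    · rw [h0, ENNReal.zero_rpow_of_pos hq, zero_mul, nonpos_iff_eq_zero,
        lintegral_eq_zero_iff ((hFa a).pow_const q)] at ha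
      filter_upwards [ha] with ω hω _
      simpa [hq, hq.not_gt] using hω
    · exact ae_of_all _ fun ω h => absurd h h0
  have hpoint : ∀ᵐ ω ∂P, (∫⁻ a, F a ω ^ p ∂μ) ^ (q / p)
      ≤ (∫⁻ a, F a ω ^ q * w a ^ (p - q) ∂μ) * (∫⁻ a, w a ^ p ∂μ) ^ (q / p - 1) := by
    filter_upwards [hzero] with ω hω
    have h1 : ∫⁻ a, F a ω ^ p ∂μ
        ≤ ∫⁻ a, (F a ω ^ q * w a ^ (p - q)) ^ (p / q) * (w a ^ p) ^ (1 - p / q) ∂μ := by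
      refine lintegral_mono_ae ?_
      filter_upwards [hω] with a ha
      by_cases h0 : w a = 0
      · rw [ha h0, ENNReal.zero_rpow_of_pos hp]
        exact zero_le
      · refine le_of_eq ?_
        rw [ENNReal.mul_rpow_of_nonneg _ _ (by positivity), ← ENNReal.rpow_mul,
          ← ENNReal.rpow_mul, ← ENNReal.rpow_mul, mul_assoc,
          ← ENNReal.rpow_add _ _ h0 (hw_top a)]
        have e1 : q * (p / q) = p := by field_simp
        have e2 : (p - q) * (p / q) + p * (1 - p / q) = 0 := by
          field_simp
          ring
        rw [e1, e2, ENNReal.rpow_zero, mul_one]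
    have h2 := h1.trans (ENNReal.lintegral_mul_norm_pow_le
      (((hFω ω).pow_const q).mul (hw.pow_const (p - q))).aemeasurable
      (hw.pow_const p).aemeasurable (by positivity : 0 ≤ p / q)
      (sub_nonneg.2 ((div_le_one hq).2 hpq)) (by ring))
    refine (ENNReal.rpow_le_rpow h2 (by positivity : 0 ≤ q / p)).trans (le_of_eq ?_)
    rw [ENNReal.mul_rpow_of_nonneg _ _ (by positivity), ← ENNReal.rpow_mul, ← ENNReal.rpow_mul]
    have e1 : p / q * (q / p) = 1 := by field_simp
    have e2 : (1 - p / q) * (q / p) = q / p - 1 := by field_simp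
    rw [e1, e2, ENNReal.rpow_one]
    rfl
  have hqp : 0 ≤ q / p - 1 := sub_nonneg.2 ((one_le_div hp).2 hpq)
  have hm : Measurable fun r : Ω × α => F r.2 r.1 ^ q * w r.2 ^ (p - q) :=
    (hFswap.pow_const q).mul ((hw.comp measurable_snd).pow_const _)
  calc _ ≤ ∫⁻ ω, (∫⁻ a, F a ω ^ q * w a ^ (p - q) ∂μ) * (∫⁻ a, w a ^ p ∂μ) ^ (q / p - 1) ∂P :=
        lintegral_mono_ae hpoint
    _ = (∫⁻ a, ∫⁻ ω, F a ω ^ q * w a ^ (p - q) ∂P ∂μ) * (∫⁻ a, w a ^ p ∂μ) ^ (q / p - 1) := by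
        rw [lintegral_mul_const _ hm.lintegral_prod_right',
          lintegral_lintegral_swap hm.aemeasurable]
    _ ≤ (∫⁻ a, K * w a ^ p ∂μ) * (∫⁻ a, w a ^ p ∂μ) ^ (q / p - 1) := by
        gcongr ?_ * _
        refine lintegral_mono_ae ?_
        filter_upwards [hmom] with a ha
        rw [lintegral_mul_const _ ((hFa a).pow_const q)]
        by_cases h0 : w a = 0
        · rw [h0, ENNReal.zero_rpow_of_pos hq, zero_mul, nonpos_iff_eq_zero] at ha
          rw [ha, zero_mul]
          exact zero_le
        · refine (mul_le_mul_left ha _).trans (le_of_eq ?_)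
          rw [mul_right_comm, ← ENNReal.rpow_add _ _ h0 (hw_top a), mul_comm]
          congr 2
          ring
    _ = _ := by
        rw [lintegral_const_mul _ (hw.pow_const p), mul_assoc]
        congr 1
        conv_lhs => rw [← ENNReal.rpow_one (∫⁻ a, w a ^ p ∂μ), ← ENNReal.rpow_mul, one_mul,
          ← ENNReal.rpow_add_of_nonneg _ _ zero_le_one hqp]
        congr 1
        ring

namespace IsContinuousCovGaussian

variable {Ω : Type*} [MeasurableSpace Ω] {P : Measure Ω} {X : ℝ → Ω → ℝ}

lemma correlogramVar_nonneg (hX : IsContinuousCovGaussian X P) {T : ℝ} (hT : 0 < T) (τ : ℝ) :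
    0 ≤ correlogramVar X P T τ := by
  refine ge_of_tendsto' (hX.tendsto_riemannVar hT τ) fun n => ?_
  let f : Fin n ⊕ Fin n → ℝ :=
    Sum.elim (fun k => (k + 1 : ℕ) * (T / n) + τ) (fun k => (k + 1 : ℕ) * (T / n))
  exact mul_nonneg (by positivity)
    (sum_sum_isserlis_nonneg (P := P) (Y := fun i => X (f i)) fun i => hX.memLp_two _)

variable [IsProbabilityMeasure P]

lemma lintegral_abs_rpow_le_of_exp (hX : IsContinuousCovGaussian X P) {T : ℝ} (hT : 0 < T)
    (τ : ℝ) {q c s : ℝ} (hq : 0 < q) (hc : 0 < c) (hs0 : 0 < s) (hs : s < 1)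
    (hvar : 2 * c ^ 2 * correlogramVar X P T τ ≤ s ^ 2) :
    ∫⁻ ω, ENNReal.ofReal |correlogram X T τ ω - correlogramMean X P T τ| ^ q ∂P
      ≤ ENNReal.ofReal ((q / c) ^ q * Real.exp (-q) * (2 * sqGaussianBound s)) := by
  have hpos : 0 ≤ (q / c) ^ q * Real.exp (-q) := by positivity
  have hb : 0 ≤ sqGaussianBound s := by unfold sqGaussianBound; positivity
  have hm : Measurable fun ω => correlogram X T τ ω - correlogramMean X P T τ :=
    (hX.measurable_correlogram_lag T τ).sub_const _
  have h1 := hX.lintegral_exp_correlogram_sub_le hT τ hs0 hs hvar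
  have h2 := hX.lintegral_exp_correlogram_sub_le hT τ (c := -c) hs0 hs (by rwa [neg_sq])
  calc _ ≤ ∫⁻ ω, ENNReal.ofReal ((q / c) ^ q * Real.exp (-q)) *
        (ENNReal.ofReal (Real.exp (c * (correlogram X T τ ω - correlogramMean X P T τ)))
        + ENNReal.ofReal (Real.exp (-c * (correlogram X T τ ω - correlogramMean X P T τ)))) ∂P := by
        refine lintegral_mono fun ω => ?_
        rw [ENNReal.ofReal_rpow_of_nonneg (abs_nonneg _) hq.le,
          ← ENNReal.ofReal_add (by positivity) (by positivity), ← ENNReal.ofReal_mul hpos]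
        refine ENNReal.ofReal_le_ofReal ((rpow_le_mul_exp (abs_nonneg _) hq hc).trans ?_)
        exact mul_le_mul_of_nonneg_left (exp_mul_abs_le _ _) hpos
    _ ≤ _ := by
        rw [lintegral_const_mul _ (by fun_prop), lintegral_add_left (by fun_prop),
          ENNReal.ofReal_mul hpos, two_mul, ENNReal.ofReal_add hb hb]
        gcongr

/-- Moments of the centered correlogram, from its Laplace transform at the point
`s / √(2 Var)`; in the degenerate case `Var = 0` the point tends to infinity. -/
lemma lintegral_abs_rpow_le (hX : IsContinuousCovGaussian X P) {T : ℝ} (hT : 0 < T)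
    (τ : ℝ) {q s : ℝ} (hq : 0 < q) (hs0 : 0 < s) (hs : s < 1) :
    ∫⁻ ω, ENNReal.ofReal |correlogram X T τ ω - correlogramMean X P T τ| ^ q ∂P
      ≤ ENNReal.ofReal √(2 * correlogramVar X P T τ) ^ q
        * ENNReal.ofReal ((q / s) ^ q * Real.exp (-q) * (2 * sqGaussianBound s)) := by
  set D := correlogramVar X P T τ with hD
  have hb : 0 ≤ sqGaussianBound s := by unfold sqGaussianBound; positivity
  rcases (hX.correlogramVar_nonneg hT τ).eq_or_lt with h0 | hpos
  · rw [← hD] at h0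
    rw [← h0, mul_zero, Real.sqrt_zero, ENNReal.ofReal_zero, ENNReal.zero_rpow_of_pos hq, zero_mul]
    have hlim : Tendsto (fun c : ℝ => ENNReal.ofReal
        ((q / c) ^ q * Real.exp (-q) * (2 * sqGaussianBound s))) atTop (𝓝 0) := by
      rw [← ENNReal.ofReal_zero]
      refine ENNReal.tendsto_ofReal ?_
      have h1 : Tendsto (fun c : ℝ => (q / c) ^ q) atTop (𝓝 0) := by
        have := (tendsto_const_nhds.div_atTop tendsto_id :
          Tendsto (fun c : ℝ => q / c) atTop (𝓝 0)).rpow_const (p := q) (Or.inr hq.le)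
        rwa [Real.zero_rpow hq.ne'] at this
      simpa using (h1.mul_const (Real.exp (-q))).mul_const (2 * sqGaussianBound s)
    refine ge_of_tendsto hlim ?_
    filter_upwards [eventually_gt_atTop 0] with c hc
    refine hX.lintegral_abs_rpow_le_of_exp hT τ hq hc hs0 hs ?_
    rw [← hD, ← h0, mul_zero]
    positivity
  · rw [← hD] at hpos
    have hw : 0 < √(2 * D) := by positivity
    refine (hX.lintegral_abs_rpow_le_of_exp hT τ hq (c := s / √(2 * D)) (by positivity) hs0 hs
      (le_of_eq ?_)).trans (le_of_eq ?_)
    · rw [div_pow, Real.sq_sqrt (by positivity), ← hD]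
      field_simp
    · rw [ENNReal.ofReal_rpow_of_nonneg hw.le hq.le, ← ENNReal.ofReal_mul (by positivity)]
      congr 1
      have e : q / (s / √(2 * D)) = √(2 * D) * (q / s) := by field_simp
      rw [e, Real.mul_rpow hw.le (by positivity)]
      ring

omit [IsProbabilityMeasure P] in
lemma continuous_correlogramMean (hX : IsContinuousCovGaussian X P) (T : ℝ) :
    Continuous (correlogramMean X P T) := by
  unfold correlogramMean
  refine continuous_const.mul
    (intervalIntegral.continuous_parametric_intervalIntegral_of_continuous' ?_ _ _)
  exact hX.continuous_cov.comp (by fun_prop : Continuous fun q : ℝ × ℝ => (q.2 + q.1, q.2))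

omit [IsProbabilityMeasure P] in
lemma measurable_deviation (hX : IsContinuousCovGaussian X P) (T : ℝ) :
    Measurable fun r : ℝ × Ω =>
      ENNReal.ofReal |correlogram X T r.1 r.2 - correlogramMean X P T r.1| := by
  have h : Measurable fun r : ℝ × Ω => correlogram X T r.1 r.2 - correlogramMean X P T r.1 :=
    (hX.measurable_correlogram T).sub
      ((hX.continuous_correlogramMean T).measurable.comp measurable_fst)
  exact (measurable_norm.comp h).ennreal_ofReal

/-- The moment of order `q / p` of `∫₀ᴬ |ρ̂ - E ρ̂|^p`; since `|ρ̂ - E ρ̂|` has `q`-th moments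
proportional to `(2 V)^{q / 2}`, the weight in Minkowski's inequality is `√(2 V)`. -/
lemma lintegral_rpow_lintegral_correlogram_le (hX : IsContinuousCovGaussian X P) {T A p q s : ℝ}
    (hT : 0 < T) (hA : 0 < A) (hp : 0 < p) (hpq : p ≤ q) (hs0 : 0 < s) (hs : s < 1)
    {V : ℝ → ℝ} (hVc : Continuous V)
    (hV : ∀ τ ∈ Set.Icc 0 A, correlogramVar X P T τ = V τ) :
    ∫⁻ ω, (∫⁻ τ in Set.Ioc 0 A,
        ENNReal.ofReal |correlogram X T τ ω - correlogramMean X P T τ| ^ p) ^ (q / p) ∂P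
      ≤ ENNReal.ofReal ((q / s) ^ q * Real.exp (-q) * (2 * sqGaussianBound s)
        * (2 ^ (p / 2) * ∫ τ in (0 : ℝ)..A, V τ ^ (p / 2)) ^ (q / p)) := by
  have hq : 0 < q := hp.trans_le hpq
  have hb : 0 ≤ sqGaussianBound s := by unfold sqGaussianBound; positivity
  set K : ℝ := (q / s) ^ q * Real.exp (-q) * (2 * sqGaussianBound s) with hK
  have hK0 : 0 ≤ K := by positivity
  have hFm := hX.measurable_deviation T
  set w : ℝ → ℝ≥0∞ := fun τ => ENNReal.ofReal √(2 * V τ) with hw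
  have hVnonneg : ∀ τ ∈ Set.Icc 0 A, 0 ≤ V τ := fun τ hτ =>
    (hV τ hτ).symm ▸ hX.correlogramVar_nonneg hT τ
  have hwm : Measurable w := (Continuous.measurable (by fun_prop)).ennreal_ofReal
  have hmom : ∀ᵐ τ ∂(volume.restrict (Set.Ioc 0 A)),
      ∫⁻ ω, ENNReal.ofReal |correlogram X T τ ω - correlogramMean X P T τ| ^ q ∂P
        ≤ w τ ^ q * ENNReal.ofReal K := by
    refine (ae_restrict_iff' measurableSet_Ioc).2 (ae_of_all _ fun τ hτ => ?_)
    rw [hw]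
    simp only [← hV τ (Set.Ioc_subset_Icc_self hτ)]
    exact hX.lintegral_abs_rpow_le hT τ hq hs0 hs
  have key := lintegral_rpow_lintegral_rpow_le (F := fun τ ω =>
    ENNReal.ofReal |correlogram X T τ ω - correlogramMean X P T τ|) hFm hwm
    (fun _ => ENNReal.ofReal_ne_top) hp hpq hmom
  have hwint : ∫⁻ τ in Set.Ioc 0 A, w τ ^ p
      = ENNReal.ofReal (2 ^ (p / 2) * ∫ τ in (0 : ℝ)..A, V τ ^ (p / 2)) := by
    have hc : Continuous fun τ => 2 ^ (p / 2) * V τ ^ (p / 2) :=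
      continuous_const.mul (hVc.rpow_const fun _ => Or.inr (by positivity))
    rw [← intervalIntegral.integral_const_mul, intervalIntegral.integral_of_le hA.le,
      ofReal_integral_eq_lintegral_ofReal (hc.integrableOn_Ioc)]
    · refine setLIntegral_congr_fun measurableSet_Ioc fun τ hτ => ?_
      simp only [hw]
      rw [ENNReal.ofReal_rpow_of_nonneg (Real.sqrt_nonneg _) hp.le,
        ← Real.mul_rpow zero_le_two (hVnonneg τ (Set.Ioc_subset_Icc_self hτ)),
        Real.sqrt_eq_rpow, ← Real.rpow_mul
          (mul_nonneg zero_le_two (hVnonneg τ (Set.Ioc_subset_Icc_self hτ)))]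
      ring_nf
    · refine (ae_restrict_iff' measurableSet_Ioc).2 (ae_of_all _ fun τ hτ => ?_)
      have := hVnonneg τ (Set.Ioc_subset_Icc_self hτ)
      exact mul_nonneg (by positivity) (Real.rpow_nonneg this _)
  have hNnonneg : 0 ≤ 2 ^ (p / 2) * ∫ τ in (0 : ℝ)..A, V τ ^ (p / 2) :=
    mul_nonneg (by positivity) (intervalIntegral.integral_nonneg hA.le fun τ hτ =>
      Real.rpow_nonneg (hVnonneg τ hτ) _)
  rw [hwint, ENNReal.ofReal_rpow_of_nonneg hNnonneg (by positivity),
    ← ENNReal.ofReal_mul hK0] at key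
  exact key

/-- Markov's inequality for the moment of order `q / p` of `∫₀ᴬ |ρ̂ - E ρ̂|^p`. -/
lemma measure_lt_integral_le (hX : IsContinuousCovGaussian X P) {T A p q s ε : ℝ} (hT : 0 < T)
    (hA : 0 < A) (hp : 0 < p) (hpq : p ≤ q) (hs0 : 0 < s) (hs : s < 1) (hε : 0 < ε)
    {V : ℝ → ℝ} (hVc : Continuous V)
    (hV : ∀ τ ∈ Set.Icc 0 A, correlogramVar X P T τ = V τ) :
    P {ω | ε < ∫ τ in (0 : ℝ)..A, |correlogram X T τ ω - correlogramMean X P T τ| ^ p}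
      ≤ ENNReal.ofReal ((q / s) ^ q * Real.exp (-q) * (2 * sqGaussianBound s)
        * (2 ^ (p / 2) * ∫ τ in (0 : ℝ)..A, V τ ^ (p / 2)) ^ (q / p) / ε ^ (q / p)) := by
  have hq : 0 < q := hp.trans_le hpq
  set F : ℝ → Ω → ℝ≥0∞ := fun τ ω =>
    ENNReal.ofReal |correlogram X T τ ω - correlogramMean X P T τ| with hF
  have hJm : Measurable fun ω => (∫⁻ τ in Set.Ioc 0 A, F τ ω ^ p) ^ (q / p) := by
    have h : Measurable fun r : Ω × ℝ => F r.2 r.1 ^ p :=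
      ((hX.measurable_deviation T).comp measurable_swap).pow_const p
    exact (h.lintegral_prod_right').pow_const _
  calc _ ≤ P {ω | ENNReal.ofReal (ε ^ (q / p)) ≤ (∫⁻ τ in Set.Ioc 0 A, F τ ω ^ p) ^ (q / p)} := by
        refine measure_mono fun ω hω => ?_
        simp only [Set.mem_ofPred_eq] at hω ⊢
        rw [← ENNReal.ofReal_rpow_of_pos hε]
        refine ENNReal.rpow_le_rpow ?_ (by positivity)
        refine (ENNReal.ofReal_le_ofReal hω.le).trans ?_
        rw [intervalIntegral.integral_of_le hA.le]
        have h1 := enorm_integral_le_lintegral_enorm (μ := volume.restrict (Set.Ioc 0 A))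
          (fun τ => |correlogram X T τ ω - correlogramMean X P T τ| ^ p)
        rw [Real.enorm_eq_ofReal (integral_nonneg fun τ => by positivity)] at h1
        refine h1.trans (le_of_eq (lintegral_congr fun τ => ?_))
        rw [Real.enorm_eq_ofReal (by positivity), hF]
        exact (ENNReal.ofReal_rpow_of_nonneg (abs_nonneg _) hp.le).symm
    _ ≤ (∫⁻ ω, (∫⁻ τ in Set.Ioc 0 A, F τ ω ^ p) ^ (q / p) ∂P) / ENNReal.ofReal (ε ^ (q / p)) :=
        meas_ge_le_lintegral_div hJm.aemeasurable (by
          rw [Ne, ENNReal.ofReal_eq_zero, not_le]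
          positivity) ENNReal.ofReal_ne_top
    _ ≤ _ := by
        rw [ENNReal.ofReal_div_of_pos (by positivity)]
        gcongr
        exact hX.lintegral_rpow_lintegral_correlogram_le hT hA hp hpq hs0 hs hVc hV

end IsContinuousCovGaussian

/-! ### Stationary processes on an interval -/

/-- A double integral of an even function of `t - s`, by integration along the diagonals. -/
lemma integral_integral_comp_sub {h : ℝ → ℝ} (hc : Continuous h) (heven : ∀ x, h (-x) = h x)
    (T : ℝ) :
    ∫ t in (0 : ℝ)..T, ∫ s in (0 : ℝ)..T, h (t - s)
      = 2 * ∫ u in (0 : ℝ)..T, (T - u) * h u := by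
  have hi : ∀ a b, IntervalIntegrable h volume a b := fun a b => hc.intervalIntegrable a b
  let H : ℝ → ℝ := fun x => ∫ u in (0 : ℝ)..x, h u
  have hH : ∀ x, HasDerivAt H (h x) x := fun x =>
    intervalIntegral.integral_hasDerivAt_right (hi 0 x)
      (hc.stronglyMeasurableAtFilter _ _) hc.continuousAt
  have hHc : Continuous H := continuous_iff_continuousAt.2 fun x => (hH x).continuousAt
  have hneg : ∀ x, H (-x) = -H x := by
    intro x
    have := intervalIntegral.integral_comp_neg (a := 0) (b := x) h
    simp only [heven, neg_zero] at this
    simp only [H]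
    rw [this, intervalIntegral.integral_symm]
  have inner : ∀ t, ∫ s in (0 : ℝ)..T, h (t - s) = H t + H (T - t) := by
    intro t
    rw [intervalIntegral.integral_comp_sub_left h t, sub_zero]
    have e : H (T - t) = -H (t - T) := by rw [← hneg, neg_sub]
    rw [e, ← sub_eq_add_neg]
    exact (intervalIntegral.integral_interval_sub_left (hi _ _) (hi _ _)).symm
  have parts := intervalIntegral.integral_mul_deriv_eq_deriv_mul (a := 0) (b := T)
    (u := fun t => T - t) (u' := fun _ => -1) (v := H) (v' := h)
    (fun t _ => by simpa using (hasDerivAt_id t).const_sub T) (fun t _ => hH t)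
    intervalIntegrable_const (hi _ _)
  have hH0 : H 0 = 0 := intervalIntegral.integral_same
  simp only [sub_self, zero_mul, hH0, mul_zero, neg_mul, one_mul,
    intervalIntegral.integral_neg, sub_neg_eq_add, zero_add] at parts
  simp only [inner]
  have hHr : Continuous fun t => H (T - t) := hHc.comp (by fun_prop)
  rw [intervalIntegral.integral_add (hHc.intervalIntegrable _ _) (hHr.intervalIntegrable _ _),
    intervalIntegral.integral_comp_sub_left H T, parts]
  simp
  ring

/-- The optimal choice of the order `q` of the moment and of the argument `s` of the
Laplace transform bound, in terms of `x = e / a`; the assumption on `x` makes `q ≥ p`. -/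
lemma exists_optimal_parameters {p a e : ℝ} (hp : 0 < p) (ha : 0 < a) (he : 0 < e)
    (h : (p / √2 + √((p / 2 + 1) * p)) * a ≤ e) :
    ∃ q s : ℝ, p ≤ q ∧ 0 < s ∧ s < 1 ∧
      (q / s) ^ q * Real.exp (-q) * (2 * sqGaussianBound s) * (√2 * a) ^ q / e ^ q
        = 2 * √(1 + e * √2 / a) * Real.exp (-(e / (√2 * a))) := by
  set x := e / a with hx
  have hx0 : 0 < x := by positivity
  have h2 : √2 * √2 = 2 := Real.mul_self_sqrt zero_le_two
  have h2pos : 0 < √2 := by positivity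
  have hd : 0 < 1 + √2 * x := by positivity
  have hxle : p / √2 + √((p / 2 + 1) * p) ≤ x := by rwa [hx, le_div_iff₀ ha]
  have hs : √2 * x / (1 + √2 * x) < 1 := by rw [div_lt_one hd]; linarith
  have hs0 : 0 < √2 * x / (1 + √2 * x) := by positivity
  set s := √2 * x / (1 + √2 * x) with hsdef
  have hq : s * x / √2 = x ^ 2 / (1 + √2 * x) := by
    rw [hsdef]
    field_simp
  have hpq : p ≤ s * x / √2 := by
    have h3 : √((p / 2 + 1) * p) ≤ x - p / √2 := by linarith
    have h4 := pow_le_pow_left₀ (Real.sqrt_nonneg _) h3 2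
    rw [Real.sq_sqrt (by positivity)] at h4
    have h5 : p / √2 = p * √2 / 2 := by
      field_simp
      rw [sq, h2]
    rw [hq, le_div_iff₀ hd]
    rw [h5] at h4
    nlinarith [h4, h2]
  refine ⟨s * x / √2, s, hpq, hs0, hs, ?_⟩
  set q := s * x / √2 with hqdef
  have e1 : (q / s) ^ q * (√2 * a) ^ q = e ^ q := by
    rw [← Real.mul_rpow (by positivity) (by positivity)]
    congr 1
    rw [hqdef, hx]
    field_simp
  have e2 : (√(1 - s))⁻¹ = √(1 + e * √2 / a) := by
    rw [← Real.sqrt_inv]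
    congr 1
    have : 1 - s = (1 + √2 * x)⁻¹ := by
      rw [hsdef]
      field_simp
      ring
    rw [this, inv_inv, hx]
    ring
  have e3 : Real.exp (-q) * Real.exp (-s / 2) = Real.exp (-(e / (√2 * a))) := by
    rw [← Real.exp_add]
    congr 1
    have e4 : e / (√2 * a) = x / √2 := by rw [hx]; field_simp
    rw [e4, hqdef]
    have e5 : s * (1 + √2 * x) = √2 * x := by rw [hsdef]; field_simp
    have e6 : x / √2 = √2 * x / 2 := by
      field_simp
      rw [sq, h2]
    have e7 : s * x / √2 = s * (√2 * x) / 2 := by rw [mul_div_assoc, e6]; ring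
    rw [e7, e6]
    linarith
  have heq : e ^ q ≠ 0 := by positivity
  rw [div_eq_iff heq, sqGaussianBound, ← e2, ← e3, ← e1]
  ring

section Reduction

variable {Ω : Type*} [MeasurableSpace Ω] {P : Measure Ω} {X : ℝ → Ω → ℝ} {ρ : ℝ → ℝ} {L : ℝ}

/-- The process on the whole line that is constant on either side of `[0, L]` and agrees with `X`
on that interval. -/
noncomputable def extendProcess (X : ℝ → Ω → ℝ) (L : ℝ) (hL : 0 ≤ L) (t : ℝ) : Ω → ℝ :=
  X (Set.projIcc 0 L hL t)

/-- The even continuous function on the whole line that agrees with `ρ` on `[0, L]` and is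
constant beyond. -/
noncomputable def extendCov (ρ : ℝ → ℝ) (L x : ℝ) : ℝ := ρ (min |x| L)

lemma continuous_extendCov (hL : 0 ≤ L) (hρ : ContinuousOn ρ (Set.Icc 0 L)) :
    Continuous (extendCov ρ L) :=
  hρ.comp_continuous (by fun_prop) fun x => ⟨le_min (abs_nonneg x) hL, min_le_right _ _⟩

lemma extendCov_neg (x : ℝ) : extendCov ρ L (-x) = extendCov ρ L x := by
  simp [extendCov]

omit [MeasurableSpace Ω] in
lemma extendProcess_of_mem (hL : 0 ≤ L) {t : ℝ} (ht : t ∈ Set.Icc 0 L) :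
    extendProcess X L hL t = X t := by
  rw [extendProcess, Set.projIcc_of_mem hL ht]

namespace IsMeasurableStationaryGaussian

/-- Symmetry of the covariance: both values come from the pair of times `0` and `x`. -/
lemma cov_neg_of_nonneg (hX : IsMeasurableStationaryGaussian X ρ (Set.Icc 0 L) P) {x : ℝ}
    (hx : x ∈ Set.Icc 0 L) : ρ (-x) = ρ x := by
  have h0 : (0 : ℝ) ∈ Set.Icc 0 L := ⟨le_rfl, hx.1.trans hx.2⟩
  rw [← hX.covariance x (-x) hx (by simpa using h0),
    ← hX.covariance 0 x h0 (by simpa using hx)]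
  simp [mul_comm]

lemma cov_neg_of_abs_le (hX : IsMeasurableStationaryGaussian X ρ (Set.Icc 0 L) P) {x : ℝ}
    (hx : |x| ≤ L) : ρ (-x) = ρ x := by
  rw [abs_le] at hx
  rcases le_total 0 x with h | h
  · exact hX.cov_neg_of_nonneg ⟨h, hx.2⟩
  · have := hX.cov_neg_of_nonneg (x := -x) ⟨by linarith, by linarith⟩
    rw [← this, neg_neg]

lemma cov_eq_extendCov (hX : IsMeasurableStationaryGaussian X ρ (Set.Icc 0 L) P) {x : ℝ}
    (hx : |x| ≤ L) : ρ x = extendCov ρ L x := by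
  rw [extendCov, min_eq_left hx]
  rcases abs_choice x with h | h
  · rw [h]
  · rw [h, hX.cov_neg_of_abs_le hx]

lemma covKernel_extendProcess (hX : IsMeasurableStationaryGaussian X ρ (Set.Icc 0 L) P)
    (hL : 0 ≤ L) (t s : ℝ) :
    covKernel (extendProcess X L hL) P t s
      = extendCov ρ L (Set.projIcc 0 L hL t - Set.projIcc 0 L hL s) := by
  have ht := (Set.projIcc 0 L hL t).2
  have hs := (Set.projIcc 0 L hL s).2
  have h := hX.covariance (Set.projIcc 0 L hL s)
    (Set.projIcc 0 L hL t - Set.projIcc 0 L hL s) hs (by simp)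
  rw [add_sub_cancel] at h
  rw [← hX.cov_eq_extendCov, ← h]
  · rfl
  · rw [abs_le]
    constructor <;> linarith [ht.1, ht.2, hs.1, hs.2]

lemma covKernel_extendProcess_of_mem
    (hX : IsMeasurableStationaryGaussian X ρ (Set.Icc 0 L) P) (hL : 0 ≤ L) {t s : ℝ}
    (ht : t ∈ Set.Icc 0 L) (hs : s ∈ Set.Icc 0 L) :
    covKernel (extendProcess X L hL) P t s = extendCov ρ L (t - s) := by
  rw [hX.covKernel_extendProcess hL, Set.projIcc_of_mem hL ht, Set.projIcc_of_mem hL hs]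

lemma isContinuousCovGaussian_extendProcess
    (hX : IsMeasurableStationaryGaussian X ρ (Set.Icc 0 L) P) (hL : 0 ≤ L)
    (hρ : ContinuousOn ρ (Set.Icc 0 L)) :
    IsContinuousCovGaussian (extendProcess X L hL) P where
  measurable := hX.measurable.comp
    (((continuous_projIcc (h := hL)).measurable.comp measurable_fst).prodMk measurable_snd)
  gaussian := hX.gaussian.comp_right (Set.projIcc 0 L hL)
  centered t := hX.centered _ (Set.projIcc 0 L hL t).2
  continuous_cov := by
    have h : (fun q : ℝ × ℝ => ∫ ω, extendProcess X L hL q.1 ω * extendProcess X L hL q.2 ω ∂P)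
        = fun q => extendCov ρ L (Set.projIcc 0 L hL q.1 - Set.projIcc 0 L hL q.2) :=
      funext fun q => hX.covKernel_extendProcess hL q.1 q.2
    rw [h]
    have hp : Continuous fun t : ℝ => ((Set.projIcc 0 L hL t : Set.Icc 0 L) : ℝ) :=
      continuous_subtype_val.comp continuous_projIcc
    exact (continuous_extendCov hL hρ).comp
      ((hp.comp continuous_fst).sub (hp.comp continuous_snd))

variable {T A : ℝ}

lemma correlogramMean_extendProcess
    (hX : IsMeasurableStationaryGaussian X ρ (Set.Icc 0 (T + A)) P) (hT : 0 < T)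
    (hL : 0 ≤ T + A) {τ : ℝ} (hτ : τ ∈ Set.Icc 0 A) :
    correlogramMean (extendProcess X (T + A) hL) P T τ = ρ τ := by
  have h : ∫ t in (0 : ℝ)..T, covKernel (extendProcess X (T + A) hL) P (t + τ) t
      = ∫ _ in (0 : ℝ)..T, ρ τ := by
    refine intervalIntegral.integral_congr fun t ht => ?_
    rw [Set.uIcc_of_le hT.le] at ht
    have h1 : |τ| ≤ T + A := by rw [abs_of_nonneg hτ.1]; linarith [hτ.2]
    rw [hX.covKernel_extendProcess_of_mem hL ⟨by linarith [ht.1, hτ.1], by linarith [ht.2, hτ.2]⟩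
      ⟨ht.1, by linarith [ht.2, hτ.1, hτ.2]⟩, add_sub_cancel_left, hX.cov_eq_extendCov h1]
  rw [correlogramMean, h, intervalIntegral.integral_const, sub_zero, smul_eq_mul]
  field_simp

lemma correlogramVar_extendProcess
    (hX : IsMeasurableStationaryGaussian X ρ (Set.Icc 0 (T + A)) P) (hT : 0 < T)
    (hL : 0 ≤ T + A) (hρ : ContinuousOn ρ (Set.Icc 0 (T + A))) {τ : ℝ} (hτ : τ ∈ Set.Icc 0 A) :
    correlogramVar (extendProcess X (T + A) hL) P T τ
      = (2 / T ^ 2) * ∫ u in (0 : ℝ)..T, (T - u) * (extendCov ρ (T + A) u ^ 2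
          + extendCov ρ (T + A) (u + τ) * extendCov ρ (T + A) (u - τ)) := by
  set r := extendCov ρ (T + A) with hr
  have hrc : Continuous r := continuous_extendCov hL hρ
  have h : ∫ t in (0 : ℝ)..T, ∫ s in (0 : ℝ)..T,
        productCov (extendProcess X (T + A) hL) P τ (t, s)
      = ∫ t in (0 : ℝ)..T, ∫ s in (0 : ℝ)..T,
        (fun u => r u ^ 2 + r (u + τ) * r (u - τ)) (t - s) := by
    refine intervalIntegral.integral_congr fun t ht => ?_
    refine intervalIntegral.integral_congr fun s hs => ?_
    rw [Set.uIcc_of_le hT.le] at ht hs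
    have m1 : ∀ v ∈ Set.Icc 0 T, v ∈ Set.Icc 0 (T + A) := fun v hv =>
      ⟨hv.1, by linarith [hv.2, hτ.1, hτ.2]⟩
    have m2 : ∀ v ∈ Set.Icc 0 T, v + τ ∈ Set.Icc 0 (T + A) := fun v hv =>
      ⟨by linarith [hv.1, hτ.1], by linarith [hv.2, hτ.2]⟩
    simp only [productCov]
    rw [hX.covKernel_extendProcess_of_mem hL (m2 t ht) (m2 s hs),
      hX.covKernel_extendProcess_of_mem hL (m1 t ht) (m1 s hs),
      hX.covKernel_extendProcess_of_mem hL (m2 t ht) (m1 s hs),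
      hX.covKernel_extendProcess_of_mem hL (m2 s hs) (m1 t ht), ← hr]
    have e1 : s + τ - t = -(t - s - τ) := by ring
    have e2 : t + τ - s = t - s + τ := by ring
    rw [add_sub_add_right_eq_sub, e1, e2, hr, extendCov_neg, sq]
  rw [correlogramVar, h, integral_integral_comp_sub
    (h := fun u => r u ^ 2 + r (u + τ) * r (u - τ)) (by fun_prop) fun x => ?_]
  · ring
  · have e1 : -x + τ = -(x - τ) := by ring
    have e2 : -x - τ = -(x + τ) := by ring
    simp only [e1, e2, hr, extendCov_neg]
    ring

lemma correlogramConst_eq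
    (hX : IsMeasurableStationaryGaussian X ρ (Set.Icc 0 (T + A)) P) (hT : 0 < T)
    (hA : 0 < A) (p : ℝ) :
    correlogramConst ρ T A p = ∫ τ in (0 : ℝ)..A,
      ((2 / T ^ 2) * ∫ u in (0 : ℝ)..T, (T - u) * (extendCov ρ (T + A) u ^ 2
          + extendCov ρ (T + A) (u + τ) * extendCov ρ (T + A) (u - τ))) ^ (p / 2) := by
  refine intervalIntegral.integral_congr fun τ hτ => ?_
  rw [Set.uIcc_of_le hA.le] at hτ
  congr 2
  refine intervalIntegral.integral_congr fun u hu => ?_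
  rw [Set.uIcc_of_le hT.le] at hu
  rw [hX.cov_eq_extendCov (x := u), hX.cov_eq_extendCov (x := u + τ),
    hX.cov_eq_extendCov (x := u - τ)] <;>
  · rw [abs_le]
    constructor <;> linarith [hu.1, hu.2, hτ.1, hτ.2]

end IsMeasurableStationaryGaussian

omit [MeasurableSpace Ω] in
lemma correlogram_extendProcess {T A : ℝ} (hT : 0 < T) (hL : 0 ≤ T + A) {τ : ℝ}
    (hτ : τ ∈ Set.Icc 0 A) (ω : Ω) :
    correlogram (extendProcess X (T + A) hL) T τ ω = correlogram X T τ ω := by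
  rw [correlogram, correlogram]
  congr 1
  refine intervalIntegral.integral_congr fun t ht => ?_
  rw [Set.uIcc_of_le hT.le] at ht
  rw [extendProcess_of_mem hL ⟨by linarith [ht.1, hτ.1], by linarith [ht.2, hτ.2]⟩,
    extendProcess_of_mem hL ⟨ht.1, by linarith [ht.2, hτ.1, hτ.2]⟩]

end Reduction

theorem mainTheorem2 {Ω : Type*} [MeasurableSpace Ω] (P : Measure Ω) [IsProbabilityMeasure P]
    (T A p : ℝ) (hT : 0 < T) (hA : 0 < A) (hp : 1 ≤ p)
    (X : ℝ → Ω → ℝ) (ρ : ℝ → ℝ)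
    (hX : IsMeasurableStationaryGaussian X ρ (Set.Icc 0 (T + A)) P)
    (hρ : ContinuousOn ρ (Set.Icc 0 (T + A))) :
    -- almost surely, the correlogram is a convergent integral for every lag
    (∀ᵐ ω ∂P, ∀ τ ∈ Set.Icc 0 A,
      IntervalIntegrable (fun t => X (t + τ) ω * X t ω) volume 0 T) ∧
    -- almost surely, the integral of the `p`-th power of the deviation exists
    (∀ᵐ ω ∂P,
      IntervalIntegrable (fun τ => |correlogram X T τ ω - ρ τ| ^ p) volume 0 A) ∧
    -- the tail bound
    (∀ ε : ℝ, (p / √2 + √((p / 2 + 1) * p)) ^ p * correlogramConst ρ T A p ≤ ε →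
      P {ω | ε < ∫ τ in (0 : ℝ)..A, |correlogram X T τ ω - ρ τ| ^ p} ≤
        ENNReal.ofReal
          (2 * √(1 + ε ^ (1 / p) * √2 / correlogramConst ρ T A p ^ (1 / p)) *
            Real.exp (-(ε ^ (1 / p) / (√2 * correlogramConst ρ T A p ^ (1 / p)))))) := by
  have hp0 : 0 < p := by linarith
  have hL : 0 ≤ T + A := by linarith
  set X' := extendProcess X (T + A) hL with hX'def
  have hX' : IsContinuousCovGaussian X' P := hX.isContinuousCovGaussian_extendProcess hL hρ
  set r := extendCov ρ (T + A) with hr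
  have hrc : Continuous r := continuous_extendCov hL hρ
  set V : ℝ → ℝ := fun τ => (2 / T ^ 2) * ∫ u in (0 : ℝ)..T,
    (T - u) * (r u ^ 2 + r (u + τ) * r (u - τ))
  have hVc : Continuous V := continuous_const.mul
    (intervalIntegral.continuous_parametric_intervalIntegral_of_continuous' (by fun_prop) _ _)
  have hV : ∀ τ ∈ Set.Icc 0 A, correlogramVar X' P T τ = V τ := fun τ hτ =>
    hX.correlogramVar_extendProcess hT hL hρ hτ
  have hC : correlogramConst ρ T A p = ∫ τ in (0 : ℝ)..A, V τ ^ (p / 2) :=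
    hX.correlogramConst_eq hT hA p
  have hdev : ∀ ω, ∀ τ ∈ Set.Icc 0 A, |correlogram X' T τ ω - correlogramMean X' P T τ| ^ p
      = |correlogram X T τ ω - ρ τ| ^ p := fun ω τ hτ => by
    rw [correlogram_extendProcess hT hL hτ, hX.correlogramMean_extendProcess hT hL hτ]
  refine ⟨?_, ?_, fun ε hε => ?_⟩
  · filter_upwards [hX'.ae_intervalIntegrable_mul hT 0 A] with ω hω τ hτ
    refine IntervalIntegrable.congr (fun t ht => ?_) (hω τ hτ)
    rw [Set.uIoc_of_le hT.le] at ht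
    simp only [hX'def]
    rw [extendProcess_of_mem hL ⟨by linarith [ht.1, hτ.1], by linarith [ht.2, hτ.2]⟩,
      extendProcess_of_mem hL ⟨ht.1.le, by linarith [ht.2, hτ.1, hτ.2]⟩]
  · -- the integral has a finite expectation, by the moment bound of order `1`
    have hmom := hX'.lintegral_rpow_lintegral_correlogram_le hT hA hp0 le_rfl
      (s := 1 / 2) (by norm_num) (by norm_num) hVc hV
    rw [div_self hp0.ne'] at hmom
    simp only [ENNReal.rpow_one] at hmom
    have hm : Measurable fun q : Ω × ℝ =>
        ENNReal.ofReal |correlogram X' T q.2 q.1 - correlogramMean X' P T q.2| ^ p :=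
      ((hX'.measurable_deviation T).comp measurable_swap).pow_const p
    filter_upwards [ae_lt_top hm.lintegral_prod_right'
      (hmom.trans_lt ENNReal.ofReal_lt_top).ne] with ω hω
    have hmeas : Measurable fun τ => |correlogram X' T τ ω - correlogramMean X' P T τ| ^ p :=
      (measurable_norm.comp (((hX'.measurable_correlogram T).comp measurable_prodMk_right).sub
        (hX'.continuous_correlogramMean T).measurable)).pow_const p
    have hint : IntervalIntegrable
        (fun τ => |correlogram X' T τ ω - correlogramMean X' P T τ| ^ p) volume 0 A := by
      rw [intervalIntegrable_iff_integrableOn_Ioc_of_le hA.le]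
      refine ⟨hmeas.aestronglyMeasurable, ?_⟩
      refine (le_of_eq (lintegral_congr fun τ => ?_)).trans_lt hω
      rw [Real.enorm_eq_ofReal (by positivity)]
      exact (ENNReal.ofReal_rpow_of_nonneg (abs_nonneg _) hp0.le).symm
    refine IntervalIntegrable.congr (fun τ hτ => ?_) hint
    rw [Set.uIoc_of_le hA.le] at hτ
    exact hdev ω τ (Set.Ioc_subset_Icc_self hτ)
  · set N := correlogramConst ρ T A p with hN
    have hN0 : 0 ≤ N := by
      rw [hC]
      exact intervalIntegral.integral_nonneg hA.le fun τ hτ =>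
        Real.rpow_nonneg (hV τ hτ ▸ hX'.correlogramVar_nonneg hT τ) _
    rcases hN0.eq_or_lt with h0 | hNpos
    · -- the quotients by `C_p ^ (1 / p) = 0` vanish, and the bound reads `2`
      rw [← h0, Real.zero_rpow (by positivity)]
      refine prob_le_one.trans ?_
      simp
    · have hκ : 0 < p / √2 + √((p / 2 + 1) * p) := by positivity
      have hεpos : 0 < ε := lt_of_lt_of_le (by positivity) hε
      have hpinv : 1 / p * p = 1 := by field_simp
      have hle : (p / √2 + √((p / 2 + 1) * p)) * N ^ (1 / p) ≤ ε ^ (1 / p) := by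
        have := Real.rpow_le_rpow (by positivity) hε (by positivity : 0 ≤ 1 / p)
        rwa [Real.mul_rpow (by positivity) hN0, ← Real.rpow_mul hκ.le, mul_one_div_cancel hp0.ne',
          Real.rpow_one] at this
      obtain ⟨q, s, hpq, hs0, hs, hopt⟩ := exists_optimal_parameters hp0
        (by positivity : 0 < N ^ (1 / p)) (by positivity : 0 < ε ^ (1 / p)) hle
      have htail := hX'.measure_lt_integral_le hT hA hp0 hpq hs0 hs hεpos hVc hV
      have hset : ∀ ω, ∫ τ in (0 : ℝ)..A, |correlogram X' T τ ω - correlogramMean X' P T τ| ^ p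
          = ∫ τ in (0 : ℝ)..A, |correlogram X T τ ω - ρ τ| ^ p := fun ω =>
        intervalIntegral.integral_congr fun τ hτ =>
          hdev ω τ (by rwa [Set.uIcc_of_le hA.le] at hτ)
      simp only [hset] at htail
      refine htail.trans (le_of_eq ?_)
      rw [← hopt, ← hC]
      have e1 : ε ^ (q / p) = (ε ^ (1 / p)) ^ q := by
        rw [← Real.rpow_mul hεpos.le]
        congr 1
        ring
      have e2 : (2 ^ (p / 2) * N) ^ (q / p) = (√2 * N ^ (1 / p)) ^ q := by
        have e3 : 2 ^ (p / 2) * N = (√2 * N ^ (1 / p)) ^ p := by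
          rw [Real.mul_rpow (by positivity) (by positivity), ← Real.rpow_mul hN0, hpinv,
            Real.rpow_one, Real.sqrt_eq_rpow, ← Real.rpow_mul zero_le_two]
          ring_nf
        rw [e3, ← Real.rpow_mul (by positivity)]
        congr 1
        field_simp
      rw [e1, e2]
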